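/- \textbf{Setting.} Fix a complete separable metric space $\Xi$. A \emph{network} is a connected, locally finite multigraph (loops and parallel edges allowed) with a mark in $\Xi$ for every vertex and for every pair (vertex, incident edge); isomorphisms preserve the graph structure and the marks. Let $\mathcal G$, $\mathcal G_*$, $\mathcal G_{**}$ be the sets of isomorphism classes $[G]$, $[G,o]$, $[G,o,v]$ of networks, of networks with one distinguished vertex (root), and of networks with an ordered pair of roots. Equip $\mathcal G_*$ and $\mathcal G_{**}$ with the Borel sigma-fields of the local topology (two rooted networks are close if large balls around their roots are isomorphic by a root-preserving isomorphism whose corresponding marks are close). Let $\pi_1[G,o,v]=[G,o]$, $\pi_2[G,o,v]=[G,v]$, $\pi[G,o]=[G]$, and equip $\mathcal G$ with the sigma-field $J=\{B:\pi^{-1}(B)\text{ is measurable}\}$. The \emph{invariant sigma-field} $I$ on $\mathcal G_*$ consists of the measurable $A$ such that $[G,o]\in A$ implies $[G,v]\in A$ for all $v\in V(G)$. For probability measures $\mu,\nu$ on $\mathcal G_*$: $\nu$ is obtained from $\mu$ by \emph{biasing} if there is a measurable $w:\mathcal G_*\to\mathbb R^{\ge 0}$ with $0<\int w\,d\mu<\infty$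 and $\nu(A)=\frac{1}{\int w\,d\mu}\int_A w\,d\mu$ for all measurable $A$. $\nu$ is obtained from $\mu$ by a \emph{root-change} if there is a measurable $T:\mathcal G_{**}\to\mathbb R^{\ge0}$ with $\sum_{v\in V(G)}T[G,o,v]=1$ for $\mu$-almost every $[G,o]$ and $\nu(A)=\int \sum_{v\in V(G)}T[G,o,v]\,1_A[G,v]\,d\mu([G,o])$ for all measurable $A$. \textbf{Theorem.} Let $\mu_1,\mu_2$ be probability measures on $\mathcal G_*$ (the distributions of two random rooted networks, not necessarily unimodular). The following conditions are equivalent: (R) $\mu_2$ is obtained from $\mu_1$ by a root-change. (C) There is a probability measure on $\mathcal G_*\times\mathcal G_*$ with marginals $\mu_1$ and $\mu_2$ that is concentrated on $\{([G_1,o_1],[G_2,o_2]):[G_1]=[G_2]\}$. (D) There is a probability measure $\rho$ on $\mathcal G_{**}$ with $\pi_{1*}\rho=\mu_1$ and $\pi_{2*}\rho=\mu_2$. (F) $\pi_*\mu_1=\pi_*\mu_2$ on $(\mathcal G,J)$; equivalently, $\mu_1$ and $\mu_2$ agree on $I$. Moreover, each of them implies (B) each of $\mu_1$ and $\mu_2$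 is obtained from the other by a biasing followed by a root-change. -/

import Mathlib

open MeasureTheory
open scoped ENNReal NNReal Graph

universe u

noncomputable section

namespace UnrootedEquivalence

/-! ### Multigraphs and networks -/

/-- An isomorphism of multigraphs (loops and parallel edges are allowed): bijections of the vertices
and of the edges that preserve the relation "`e` has ends `x` and `y`". -/
structure GraphIso {α β α' β' : Type} (G : Graph α β) (H : Graph α' β') where
  onV : V(G) ≃ V(H)
  onE : E(G) ≃ E(H)
  isLink_iff : ∀ (e : E(G)) (x y : V(G)),
    H.IsLink (onE e : β') (onV x : α') (onV y : α') ↔ G.IsLink (e : β) (x : α) (y : α)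

/-- A multigraph with marks in `Ξ`: a mark for every vertex and a mark for every pair of a vertex
and an edge incident to it. A connected locally finite graph is countable, so up to isomorphism
nothing is lost by taking vertices and edges in `Type`. -/
structure MarkedGraph (Ξ : Type u) where
  V : Type
  E : Type
  graph : Graph V E
  vertexMark : V(graph) → Ξ
  edgeMark : (v : V) → (e : E) → graph.Inc e v → Ξ

variable {Ξ : Type u}

/-- The restriction of a marked graph to a set `S` of vertices (all edges with both ends in `S` are
kept, with their marks). -/
def MarkedGraph.induce (G : MarkedGraph Ξ) (S : Set G.V) (hS : S ⊆ V(G.graph)) :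
    MarkedGraph Ξ where
  V := G.V
  E := G.E
  graph := G.graph.induce S
  vertexMark v := G.vertexMark ⟨v, hS v.2⟩
  edgeMark v e h := G.edgeMark v e (h.imp fun _ hy => hy.1)

/-- All corresponding marks of the two marked graphs are related by `P`. -/
def MarksRelated (P : Ξ → Ξ → Prop) {G H : MarkedGraph Ξ} (φ : GraphIso G.graph H.graph) : Prop :=
  (∀ v : V(G.graph), P (G.vertexMark v) (H.vertexMark (φ.onV v))) ∧
  ∀ (v : V(G.graph)) (e : E(G.graph)) (h : G.graph.Inc e v)
    (h' : H.graph.Inc (φ.onE e) (φ.onV v)), P (G.edgeMark v e h) (H.edgeMark (φ.onV v) (φ.onE e) h')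

/-- Graph distance between two vertices. -/
def MarkedGraph.dist (G : MarkedGraph Ξ) (v w : V(G.graph)) : ℕ := G.graph.toSimpleGraph.dist v w

/-- A network: a marked multigraph that is connected and locally finite. -/
structure Network (Ξ : Type u) extends MarkedGraph Ξ where
  connected : graph.toSimpleGraph.Connected
  locallyFinite : ∀ v ∈ V(graph), {e | graph.Inc e v}.Finite

/-- The vertices of a network. -/
abbrev Network.Vert (G : Network Ξ) : Type := V(G.graph)

/-- A network isomorphism: a graph isomorphism that preserves all marks. -/
structure NetworkIso (G H : Network Ξ) extends GraphIso G.graph H.graph where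
  marks : MarksRelated (G := G.toMarkedGraph) (H := H.toMarkedGraph) Eq toGraphIso

/-- A network with an ordered `k`-tuple of distinguished vertices. -/
structure RootedNetwork (Ξ : Type u) (k : ℕ) where
  net : Network Ξ
  root : Fin k → net.Vert

/-! ### Isomorphism classes -/

def GraphIso.refl {α β : Type} (G : Graph α β) : GraphIso G G where
  onV := Equiv.refl _
  onE := Equiv.refl _
  isLink_iff _ _ _ := Iff.rfl

def GraphIso.symm {α β α' β' : Type} {G : Graph α β} {H : Graph α' β'} (φ : GraphIso G H) :
    GraphIso H G where
  onV := φ.onV.symm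
  onE := φ.onE.symm
  isLink_iff e x y := by
    simpa using (φ.isLink_iff (φ.onE.symm e) (φ.onV.symm x) (φ.onV.symm y)).symm

def GraphIso.trans {α β α' β' α'' β'' : Type} {G : Graph α β} {H : Graph α' β'}
    {K : Graph α'' β''} (φ : GraphIso G H) (ψ : GraphIso H K) : GraphIso G K where
  onV := φ.onV.trans ψ.onV
  onE := φ.onE.trans ψ.onE
  isLink_iff e x y := (ψ.isLink_iff _ _ _).trans (φ.isLink_iff e x y)

theorem GraphIso.inc {α β α' β' : Type} {G : Graph α β} {H : Graph α' β'} (φ : GraphIso G H)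
    (e : E(G)) (v : V(G)) (h : G.Inc (e : β) (v : α)) : H.Inc (φ.onE e : β') (φ.onV v : α') := by
  obtain ⟨y, hy⟩ := h
  exact ⟨_, (φ.isLink_iff e v ⟨y, hy.right_mem⟩).2 hy⟩

theorem MarkedGraph.edgeMark_congr (G : MarkedGraph Ξ) {v w : G.V} {e f : G.E} (hv : v = w)
    (he : e = f) (h : G.graph.Inc e v) (h' : G.graph.Inc f w) :
    G.edgeMark v e h = G.edgeMark w f h' := by
  subst hv he; rfl

def NetworkIso.refl (G : Network Ξ) : NetworkIso G G where
  toGraphIso := GraphIso.refl _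
  marks := ⟨fun _ => rfl, fun _ _ _ _ => rfl⟩

def NetworkIso.symm {G H : Network Ξ} (φ : NetworkIso G H) : NetworkIso H G where
  toGraphIso := φ.toGraphIso.symm
  marks := by
    refine ⟨fun v => ?_, fun v e h h' => ?_⟩
    · have := φ.marks.1 (φ.onV.symm v)
      simp only [Equiv.apply_symm_apply] at this
      exact this.symm
    · have := φ.marks.2 (φ.onV.symm v) (φ.onE.symm e) h' (φ.toGraphIso.inc _ _ h')
      exact (this.trans (H.edgeMark_congr (by simp) (by simp) _ _)).symm

def NetworkIso.trans {G H K : Network Ξ} (φ : NetworkIso G H) (ψ : NetworkIso H K) :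
    NetworkIso G K where
  toGraphIso := φ.toGraphIso.trans ψ.toGraphIso
  marks := ⟨fun v => (φ.marks.1 v).trans (ψ.marks.1 _), fun v e h h' =>
    (φ.marks.2 v e h (φ.toGraphIso.inc _ _ h)).trans (ψ.marks.2 _ _ _ h')⟩

/-- Isomorphism of (non-rooted) networks. -/
def networkSetoid (Ξ : Type u) : Setoid (Network Ξ) where
  r G H := Nonempty (NetworkIso G H)
  iseqv := ⟨fun G => ⟨.refl G⟩, fun ⟨φ⟩ => ⟨φ.symm⟩, fun ⟨φ⟩ ⟨ψ⟩ => ⟨φ.trans ψ⟩⟩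

/-- Isomorphism of `k`-rooted networks: a network isomorphism that takes each root to the
corresponding root. -/
def rootedSetoid (Ξ : Type u) (k : ℕ) : Setoid (RootedNetwork Ξ k) where
  r x y := ∃ φ : NetworkIso x.net y.net, ∀ i, φ.onV (x.root i) = y.root i
  iseqv := by
    refine ⟨fun x => ⟨.refl _, fun _ => rfl⟩, ?_, ?_⟩
    · rintro x y ⟨φ, h⟩
      exact ⟨φ.symm, fun i => by rw [← h i]; exact φ.onV.symm_apply_apply _⟩
    · rintro x y z ⟨φ, h⟩ ⟨ψ, h'⟩
      exact ⟨φ.trans ψ, fun i => (congrArg ψ.onV (h i)).trans (h' i)⟩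

/-- The set `𝒢` of isomorphism classes of networks. -/
def UnrootedClass (Ξ : Type u) := Quotient (networkSetoid Ξ)

/-- The set of isomorphism classes of `k`-rooted networks. -/
def RootedClass (Ξ : Type u) (k : ℕ) := Quotient (rootedSetoid Ξ k)

/-- The set `𝒢_*` of isomorphism classes of rooted networks. -/
abbrev GStar (Ξ : Type u) := RootedClass Ξ 1

/-- The set `𝒢_**` of isomorphism classes of doubly-rooted networks. -/
abbrev GStarStar (Ξ : Type u) := RootedClass Ξ 2

/-- `[G]`. -/
def Network.cls (G : Network Ξ) : UnrootedClass Ξ := Quotient.mk (networkSetoid Ξ) G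

/-- The isomorphism class of a `k`-rooted network. -/
def RootedNetwork.cls {k : ℕ} (x : RootedNetwork Ξ k) : RootedClass Ξ k :=
  Quotient.mk (rootedSetoid Ξ k) x

/-- `[G, o]`. -/
def Network.cls₁ (G : Network Ξ) (o : G.Vert) : GStar Ξ := RootedNetwork.cls ⟨G, ![o]⟩

/-- `[G, o, v]`. -/
def Network.cls₂ (G : Network Ξ) (o v : G.Vert) : GStarStar Ξ := RootedNetwork.cls ⟨G, ![o, v]⟩

/-- Keeping (and reordering) some of the roots. -/
def RootedClass.reroot {k m : ℕ} (f : Fin m → Fin k) : RootedClass Ξ k → RootedClass Ξ m :=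
  Quotient.map' (fun x => ⟨x.net, x.root ∘ f⟩) fun _ _ ⟨φ, h⟩ => ⟨φ, fun i => h (f i)⟩

/-- `π₁ [G, o, v] = [G, o]`. -/
def proj₁ : GStarStar Ξ → GStar Ξ := RootedClass.reroot ![0]

/-- `π₂ [G, o, v] = [G, v]`. -/
def proj₂ : GStarStar Ξ → GStar Ξ := RootedClass.reroot ![1]

/-- `π [G, o] = [G]`. -/
def forget : GStar Ξ → UnrootedClass Ξ :=
  Quotient.map' (fun x => x.net) fun _ _ ⟨φ, _⟩ => ⟨φ⟩

theorem proj₁_cls₂ (G : Network Ξ) (o v : G.Vert) : proj₁ (G.cls₂ o v) = G.cls₁ o :=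
  congrArg (fun r : Fin 1 → G.Vert => RootedNetwork.cls ⟨G, r⟩) (funext fun i => by
    fin_cases i; rfl)

theorem proj₂_cls₂ (G : Network Ξ) (o v : G.Vert) : proj₂ (G.cls₂ o v) = G.cls₁ v :=
  congrArg (fun r : Fin 1 → G.Vert => RootedNetwork.cls ⟨G, r⟩) (funext fun i => by
    fin_cases i; rfl)

theorem forget_cls₁ (G : Network Ξ) (o : G.Vert) : forget (G.cls₁ o) = G.cls := rfl

/-! ### The local topology and the sigma-fields -/

/-- The union of the closed balls of radius `r` centred at the roots. -/
def RootedNetwork.nbhd {k : ℕ} (x : RootedNetwork Ξ k) (r : ℝ) : Set x.net.V :=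
  {v | ∃ h : v ∈ V(x.net.graph), ∃ i, (x.net.dist (x.root i) ⟨v, h⟩ : ℝ) ≤ r}

theorem RootedNetwork.nbhd_subset {k : ℕ} (x : RootedNetwork Ξ k) (r : ℝ) :
    x.nbhd r ⊆ V(x.net.graph) := fun _ h => h.1

/-- The network `x` restricted to the union of the balls of radius `r` around its roots. -/
def RootedNetwork.ball {k : ℕ} (x : RootedNetwork Ξ k) (r : ℝ) : MarkedGraph Ξ :=
  x.net.induce (x.nbhd r) (x.nbhd_subset r)

/-- `x` and `y` agree up to radius `r` (for `r > 0`): there is an isomorphism of the neighborhoods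
of radius `r` of their roots that takes roots to roots and is such that each pair of corresponding
marks has distance less than `1 / r`; moreover, the roots have the same mutual graph distances. (The
last condition is void for one root.) -/
def RootedNetwork.Agree [MetricSpace Ξ] {k : ℕ} (r : ℝ) (x y : RootedNetwork Ξ k) : Prop :=
  (∀ i j, x.net.dist (x.root i) (x.root j) = y.net.dist (y.root i) (y.root j)) ∧
  ∃ φ : GraphIso (x.ball r).graph (y.ball r).graph,
    (∀ (i : Fin k) (v : V((x.ball r).graph)), v.1 = (x.root i).1 →
      (φ.onV v).1 = (y.root i).1) ∧
    MarksRelated (G := x.ball r) (H := y.ball r) (fun a b => dist a b < 1 / r) φ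

/-- The distance of two isomorphism classes: `1 / (1 + α)`, where `α ∈ [0, ∞]` is the supremum of
the radii `r > 0` up to which they agree (`0` if there are none). -/
def RootedClass.distance [MetricSpace Ξ] {k : ℕ} (a b : RootedClass Ξ k) : ℝ≥0∞ :=
  (1 + ⨆ r ∈ {r : ℝ | 0 < r ∧ ∃ x y : RootedNetwork Ξ k, x.cls = a ∧ y.cls = b ∧ x.Agree r y},
    ENNReal.ofReal r)⁻¹

/-- The topology generated by the open balls of `RootedClass.distance`. -/
instance [MetricSpace Ξ] (k : ℕ) : TopologicalSpace (RootedClass Ξ k) :=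
  TopologicalSpace.generateFrom {U | ∃ (a : RootedClass Ξ k) (t : ℝ≥0∞), U = {b | a.distance b < t}}

/-- The Borel sigma-field on `𝒢_*`, `𝒢_**`. -/
instance [MetricSpace Ξ] (k : ℕ) : MeasurableSpace (RootedClass Ξ k) := borel _

instance [MetricSpace Ξ] (k : ℕ) : BorelSpace (RootedClass Ξ k) := ⟨rfl⟩

/-- The sigma-field `J` on `𝒢`: all sets `B` such that `π⁻¹(B)` is measurable. -/
instance [MetricSpace Ξ] : MeasurableSpace (UnrootedClass Ξ) :=
  MeasurableSpace.map forget inferInstance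

/-- The invariant sigma-field `I` on `𝒢_*`: the measurable sets that are invariant under changing
the root. -/
@[reducible] def invariantField (Ξ : Type u) [MetricSpace Ξ] : MeasurableSpace (GStar Ξ) where
  MeasurableSet' A := MeasurableSet A ∧
    ∀ (G : Network Ξ) (o v : G.Vert), G.cls₁ o ∈ A → G.cls₁ v ∈ A
  measurableSet_empty := ⟨MeasurableSet.empty, fun _ _ _ h => h⟩
  measurableSet_compl A hA := ⟨hA.1.compl, fun G o v h h' => h (hA.2 G v o h')⟩
  measurableSet_iUnion f hf := ⟨MeasurableSet.iUnion fun i => (hf i).1, fun G o v h => by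
    obtain ⟨i, hi⟩ := Set.mem_iUnion.1 h
    exact Set.mem_iUnion.2 ⟨i, (hf i).2 G o v hi⟩⟩

/-! ### Biasing and root-change -/

/-- For `h : 𝒢_** → [0, ∞]`, the function `[G, o] ↦ ∑_{v ∈ V(G)} h [G, o, v]` on `𝒢_*`. -/
def sumSecondRoot (h : GStarStar Ξ → ℝ≥0∞) : GStar Ξ → ℝ≥0∞ :=
  Quotient.lift (s := rootedSetoid Ξ 1)
    (fun x => ∑' v : x.net.Vert, h (x.net.cls₂ (x.root 0) v)) (by
    rintro x y ⟨φ, hφ⟩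
    refine ((φ.onV.tsum_eq (fun v => h (y.net.cls₂ (y.root 0) v))).symm.trans ?_).symm
    refine tsum_congr fun v => congrArg h (Quotient.sound ⟨φ.symm, fun i => ?_⟩)
    fin_cases i
    · exact (congrArg φ.onV.symm (hφ 0).symm).trans (φ.onV.symm_apply_apply _)
    · exact φ.onV.symm_apply_apply v)

theorem sumSecondRoot_cls₁ (h : GStarStar Ξ → ℝ≥0∞) (G : Network Ξ) (o : G.Vert) :
    sumSecondRoot h (G.cls₁ o) = ∑' v : G.Vert, h (G.cls₂ o v) := rfl

variable [MetricSpace Ξ]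

/-- `ν` is obtained from `μ` by biasing by a measurable function `w : 𝒢_* → ℝ≥0` with
`0 < ∫ w dμ < ∞`. -/
def IsBiasing (μ ν : Measure (GStar Ξ)) : Prop :=
  ∃ w : GStar Ξ → ℝ≥0, Measurable w ∧ 0 < ∫⁻ x, w x ∂μ ∧ ∫⁻ x, w x ∂μ < ∞ ∧
    ∀ A, MeasurableSet A → ν A = (∫⁻ x, w x ∂μ)⁻¹ * ∫⁻ x in A, w x ∂μ

/-- `ν` is the root-change of `μ` by some kernel: there is a measurable `T : 𝒢_** → ℝ≥0` with
`T⁺_G(o) = 1` for `μ`-almost every `[G, o]`, and `ν` is the distribution of the network with the new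
root `v` chosen with probability `T_G(o, v)`. -/
def IsRootChange (μ ν : Measure (GStar Ξ)) : Prop :=
  ∃ T : GStarStar Ξ → ℝ≥0, Measurable T ∧
    (∀ᵐ x ∂μ, sumSecondRoot (fun z => (T z : ℝ≥0∞)) x = 1) ∧
    ∀ A, MeasurableSet A →
      ν A = ∫⁻ x, sumSecondRoot (fun z => (T z : ℝ≥0∞) * A.indicator 1 (proj₂ z)) x ∂μ

/-! ### The conditions for unrooted-equivalence -/

/-- (B) Each distribution is obtained from the other by a biasing and then a root-change. -/
def ConditionB (μ₁ μ₂ : Measure (GStar Ξ)) : Prop :=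
  (∃ ν, IsBiasing μ₁ ν ∧ IsRootChange ν μ₂) ∧ ∃ ν, IsBiasing μ₂ ν ∧ IsRootChange ν μ₁

/-- (R) The second distribution is obtained from the first one by a root-change. -/
def ConditionR (μ₁ μ₂ : Measure (GStar Ξ)) : Prop := IsRootChange μ₁ μ₂

/-- (C) There is a coupling concentrated on the pairs with the same non-rooted network. -/
def ConditionC (μ₁ μ₂ : Measure (GStar Ξ)) : Prop :=
  ∃ ρ : Measure (GStar Ξ × GStar Ξ), IsProbabilityMeasure ρ ∧ ρ.map Prod.fst = μ₁ ∧
    ρ.map Prod.snd = μ₂ ∧ ∀ᵐ p ∂ρ, forget p.1 = forget p.2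

/-- (D) There is a random doubly-rooted network `[G, o, o']` such that `[G, o]` and `[G, o']` have
the given distributions. -/
def ConditionD (μ₁ μ₂ : Measure (GStar Ξ)) : Prop :=
  ∃ ρ : Measure (GStarStar Ξ), IsProbabilityMeasure ρ ∧ ρ.map proj₁ = μ₁ ∧ ρ.map proj₂ = μ₂

/-- (F) The random non-rooted networks have the same distribution on `(𝒢, J)`. -/
def ConditionF (μ₁ μ₂ : Measure (GStar Ξ)) : Prop := μ₁.map forget = μ₂.map forget

/-- (F), second form: the distributions agree on the invariant sigma-field `I`. -/
def ConditionF' (μ₁ μ₂ : Measure (GStar Ξ)) : Prop :=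
  ∀ A, MeasurableSet[invariantField Ξ] A → μ₁ A = μ₂ A

end UnrootedEquivalence

end

open UnrootedEquivalence

/-! The substance is that agreement on the invariant sigma-field (F) produces a root-change (R). Fix
a positive weight on $\mathcal G_{**}$ whose sum over the second root is at most one. It defines a
sub-probability kernel $K$ that moves the root of $[G,o]$ and reaches every vertex of $G$. Match
greedily: transport the part of $\mu_1$ still unmatched by $K$, keep the portion that lands on the
common part (infimum) of its image and the unmatched part of $\mu_2$, subtract it on both sides, and
repeat. In the limit there remain $\nu_1,\nu_2$ such that the image of $\nu_1$ and $\nu_2$ have no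
common part: otherwise every round would move at least a fixed positive mass. So some set $A$
carries $\nu_2$ and is not reached from $\nu_1$. The saturation of $A$ is then $\nu_1$-null; it is
invariant, and matching keeps the two measures balanced on invariant sets, so it is also
$\nu_2$-null. Hence $\nu_2=0$, and $\nu_1=0$ by total mass. The matched mass is a coupling $\rho$ on
$\mathcal G_{**}$ absolutely continuous with respect to $\mu_1 K$, and its density times the weight
is the root-change function $T$ (`exists_transport`, `ConditionF'.conditionR`).

Two measurability facts support this. Sums over the second root preserve measurability
(`measurable_sumSecondRoot`): locally, the number of second roots in an open set at a fixed distance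
cannot decrease, and Dynkin's theorem does the rest. The relation $[G_1]=[G_2]$ is measurable in the
product (`measurableSet_forget_eq`), which (D) ⇒ (C) needs; this uses separability of $\Xi$ and the
fact that rooted networks agreeing up to all radii are isomorphic, a compactness argument.

The remaining implications are formal: $T$ is a density for $\rho$ in (R) ⇒ (D), and an invariant
set is a preimage under $\pi$. Condition (B) follows with constant weight, because (F) is symmetric
in the two measures. -/

noncomputable section

namespace UnrootedEquivalence

/-! ### Greedy matching of two measures along a kernel -/

section Transport

open Measure

variable {X Z : Type*} [MeasurableSpace X] [MeasurableSpace Z]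

/-- The second marginal of the transport that `K` makes of `ν`. -/
def landing (K : X → Measure Z) (q : Z → X) (ν : Measure X) : Measure X := (ν.bind K).map q

/-- The part of the transport `ν.bind K` that covers the common part of its second marginal and
`ν'`. -/
def matching (K : X → Measure Z) (q : Z → X) (ν ν' : Measure X) : Measure Z :=
  (ν.bind K).withDensity (((landing K q ν ⊓ ν').rnDeriv (landing K q ν)) ∘ q)

/-- The unmatched parts of the two measures after `n` rounds of greedy matching. -/
def residual (K : X → Measure Z) (p q : Z → X) (μ₁ μ₂ : Measure X) : ℕ → Measure X × Measure X
  | 0 => (μ₁, μ₂)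
  | n + 1 =>
    let r := residual K p q μ₁ μ₂ n
    (r.1 - (matching K q r.1 r.2).map p, r.2 - (matching K q r.1 r.2).map q)

variable {K : X → Measure Z} {p q : Z → X}

theorem bind_mono_left {ν ν' : Measure X} (hK : Measurable K) (h : ν ≤ ν') :
    ν.bind K ≤ ν'.bind K := by
  refine Measure.le_iff.2 fun s hs => ?_
  rw [bind_apply hs hK.aemeasurable, bind_apply hs hK.aemeasurable]
  exact lintegral_mono' h le_rfl

theorem landing_mono {ν ν' : Measure X} (hK : Measurable K) (hq : Measurable q) (h : ν ≤ ν') :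
    landing K q ν ≤ landing K q ν' :=
  Measure.map_mono (bind_mono_left hK h) hq

theorem isFiniteMeasure_bind (ν : Measure X) [IsFiniteMeasure ν] (hK : Measurable K)
    (hK1 : ∀ x, K x Set.univ ≤ 1) : IsFiniteMeasure (ν.bind K) := by
  refine ⟨?_⟩
  rw [bind_apply .univ hK.aemeasurable]
  calc ∫⁻ x, K x Set.univ ∂ν ≤ ∫⁻ _, 1 ∂ν := lintegral_mono hK1
    _ < ∞ := by simp

/-- The hypothesis `hKp` says at once that `K x` has mass at most one and that it charges no
`p`-preimage of a measurable set missing `x`; singletons need not be measurable. -/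
theorem map_bind_le (ν : Measure X) (hK : Measurable K) (hp : Measurable p)
    (hKp : ∀ x B, MeasurableSet B → K x (p ⁻¹' B) ≤ B.indicator 1 x) :
    (ν.bind K).map p ≤ ν := by
  refine Measure.le_iff.2 fun s hs => ?_
  rw [map_apply hp hs, bind_apply (hp hs) hK.aemeasurable]
  calc ∫⁻ x, K x (p ⁻¹' s) ∂ν ≤ ∫⁻ x, s.indicator 1 x ∂ν := lintegral_mono fun x => hKp x s hs
    _ = ν s := lintegral_indicator_one hs

theorem measure_univ_le_one_of_le_indicator
    (hKp : ∀ x B, MeasurableSet B → K x (p ⁻¹' B) ≤ B.indicator 1 x) (x : X) :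
    K x Set.univ ≤ 1 := by
  simpa using hKp x Set.univ .univ

/-- The density that defines the matching factors through `q`, so it can be pushed forward, where it
is the Radon–Nikodym derivative of the infimum. -/
theorem map_matching_right (ν ν' : Measure X) [IsFiniteMeasure ν] [IsFiniteMeasure ν']
    (hK : Measurable K) (hq : Measurable q) (hK1 : ∀ x, K x Set.univ ≤ 1) :
    (matching K q ν ν').map q = landing K q ν ⊓ ν' := by
  have := isFiniteMeasure_bind ν hK hK1
  have : IsFiniteMeasure (landing K q ν) := by unfold landing; infer_instance
  have hfin : IsFiniteMeasure (landing K q ν ⊓ ν') := isFiniteMeasure_of_le _ inf_le_left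
  have hac : landing K q ν ⊓ ν' ≪ landing K q ν := absolutelyContinuous_of_le inf_le_left
  ext s hs
  rw [map_apply hq hs, matching, withDensity_apply _ (hq hs)]
  conv_rhs => rw [← withDensity_rnDeriv_eq _ _ hac, withDensity_apply _ hs]
  conv_rhs => enter [1]; rw [landing]
  rw [setLIntegral_map hs (measurable_rnDeriv _ _) hq]
  rfl

theorem matching_le (ν ν' : Measure X) [IsFiniteMeasure ν] [IsFiniteMeasure ν']
    (hK : Measurable K) (hq : Measurable q) (hK1 : ∀ x, K x Set.univ ≤ 1) :
    matching K q ν ν' ≤ ν.bind K := by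
  have := isFiniteMeasure_bind ν hK hK1
  have : IsFiniteMeasure (landing K q ν) := by unfold landing; infer_instance
  have hfin : IsFiniteMeasure (landing K q ν ⊓ ν') := isFiniteMeasure_of_le _ inf_le_left
  have h1 : ∀ᵐ x ∂(landing K q ν), (landing K q ν ⊓ ν').rnDeriv (landing K q ν) x ≤ 1 :=
    rnDeriv_le_one_of_le inf_le_left
  have h2 : ∀ᵐ z ∂(ν.bind K), ((landing K q ν ⊓ ν').rnDeriv (landing K q ν) ∘ q) z ≤ 1 :=
    ae_of_ae_map hq.aemeasurable h1
  calc matching K q ν ν' ≤ (ν.bind K).withDensity 1 := withDensity_mono h2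
    _ = ν.bind K := withDensity_one

section Greedy

variable (μ₁ μ₂ : Measure X)

theorem residual_le (n : ℕ) : (residual K p q μ₁ μ₂ n).1 ≤ μ₁ ∧ (residual K p q μ₁ μ₂ n).2 ≤ μ₂ := by
  induction n with
  | zero => exact ⟨le_rfl, le_rfl⟩
  | succ n ih => exact ⟨sub_le.trans ih.1, sub_le.trans ih.2⟩

/-- The mass transported in the `n`-th round of greedy matching. -/
def greedyRound (K : X → Measure Z) (p q : Z → X) (μ₁ μ₂ : Measure X) (n : ℕ) : Measure Z :=
  matching K q (residual K p q μ₁ μ₂ n).1 (residual K p q μ₁ μ₂ n).2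

variable [IsFiniteMeasure μ₁] [IsFiniteMeasure μ₂]

/-- No mass is lost in the bookkeeping. Subtraction of measures is truncated, so each round has to
be bounded by the current residuals: by the first marginal of the kernel on one side, by the infimum
on the other. -/
theorem residual_add_sum (hK : Measurable K) (hp : Measurable p) (hq : Measurable q)
    (hKp : ∀ x B, MeasurableSet B → K x (p ⁻¹' B) ≤ B.indicator 1 x) (n : ℕ) (A : Set X) :
    (residual K p q μ₁ μ₂ n).1 A +
        ∑ i ∈ Finset.range n, (greedyRound K p q μ₁ μ₂ i).map p A = μ₁ A ∧
      (residual K p q μ₁ μ₂ n).2 A +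
        ∑ i ∈ Finset.range n, (greedyRound K p q μ₁ μ₂ i).map q A = μ₂ A := by
  have hK1 := measure_univ_le_one_of_le_indicator hKp
  induction n with
  | zero => simp [residual]
  | succ n ih =>
    have h := residual_le (K := K) (p := p) (q := q) μ₁ μ₂ n
    have := isFiniteMeasure_of_le _ h.1
    have := isFiniteMeasure_of_le _ h.2
    have hle1 : (greedyRound K p q μ₁ μ₂ n).map p ≤ (residual K p q μ₁ μ₂ n).1 :=
      (Measure.map_mono (matching_le _ _ hK hq hK1) hp).trans (map_bind_le _ hK hp hKp)
    have hle2 : (greedyRound K p q μ₁ μ₂ n).map q ≤ (residual K p q μ₁ μ₂ n).2 :=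
      (map_matching_right _ _ hK hq hK1).le.trans inf_le_right
    have : IsFiniteMeasure ((matching K q (residual K p q μ₁ μ₂ n).1
      (residual K p q μ₁ μ₂ n).2).map p) := isFiniteMeasure_of_le _ hle1
    have : IsFiniteMeasure ((matching K q (residual K p q μ₁ μ₂ n).1
      (residual K p q μ₁ μ₂ n).2).map q) := isFiniteMeasure_of_le _ hle2
    have e1 : (residual K p q μ₁ μ₂ (n + 1)).1 + (greedyRound K p q μ₁ μ₂ n).map p =
        (residual K p q μ₁ μ₂ n).1 := sub_add_cancel_of_le hle1
    have e2 : (residual K p q μ₁ μ₂ (n + 1)).2 + (greedyRound K p q μ₁ μ₂ n).map q =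
        (residual K p q μ₁ μ₂ n).2 := sub_add_cancel_of_le hle2
    rw [Finset.sum_range_succ, Finset.sum_range_succ, add_comm (∑ i ∈ _, _) _,
      add_comm (∑ i ∈ _, _) _, ← add_assoc, ← add_assoc, ← Measure.add_apply, ← Measure.add_apply,
      e1, e2]
    exact ih

theorem le_of_add_eq_add {a b s t m : ℝ≥0∞} (hm : m ≠ ∞) (h1 : a + t = m) (h2 : b + s = m)
    (hst : s ≤ t) : a ≤ b := by
  have ht : t ≠ ∞ := fun h => hm (by simp [← h1, h])
  refine (ENNReal.add_le_add_iff_right (ne_top_of_le_ne_top ht hst)).1 ?_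
  calc a + s ≤ a + t := by gcongr
    _ = b + s := h1.trans h2.symm

/-- If two finite measures agree on the sets that are invariant under the transports from `p z` to
`q z`, then one is carried to the other by a transport that is absolutely continuous with respect to
the kernel `K`, provided that the points reached by `K` form whole classes. -/
theorem exists_transport (hK : Measurable K) (hp : Measurable p) (hq : Measurable q)
    (hKp : ∀ x B, MeasurableSet B → K x (p ⁻¹' B) ≤ B.indicator 1 x)
    (hsat : ∀ A, MeasurableSet A → A ⊆ {x | K x (q ⁻¹' A) ≠ 0} ∧
      ∀ z, K (p z) (q ⁻¹' A) ≠ 0 ↔ K (q z) (q ⁻¹' A) ≠ 0)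
    (hinv : ∀ A, MeasurableSet A → (∀ z, p z ∈ A ↔ q z ∈ A) → μ₁ A = μ₂ A) :
    ∃ ρ : Measure Z, ρ ≪ μ₁.bind K ∧ ρ.map p = μ₁ ∧ ρ.map q = μ₂ := by
  have hK1 := measure_univ_le_one_of_le_indicator hKp
  set t := greedyRound K p q μ₁ μ₂ with ht
  set ν := residual K p q μ₁ μ₂ with hν
  have hνle := residual_le (K := K) (p := p) (q := q) μ₁ μ₂
  have hfin1 n : IsFiniteMeasure (ν n).1 := isFiniteMeasure_of_le _ (hνle n).1
  have hfin2 n : IsFiniteMeasure (ν n).2 := isFiniteMeasure_of_le _ (hνle n).2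
  have hsum := residual_add_sum (K := K) (p := p) (q := q) μ₁ μ₂ hK hp hq hKp
  have happ (f : Z → X) (hf : Measurable f) {A : Set X} (hA : MeasurableSet A) :
      (Measure.sum t).map f A = ∑' n, (t n).map f A := by
    rw [map_apply hf hA, sum_apply _ (hf hA)]
    exact tsum_congr fun n => (map_apply hf hA).symm
  have hle1 : (Measure.sum t).map p ≤ μ₁ := Measure.le_iff.2 fun A hA => by
    rw [happ p hp hA]
    exact ENNReal.tsum_le_of_sum_range_le fun n => le_add_self.trans (hsum n A).1.le
  have hle2 : (Measure.sum t).map q ≤ μ₂ := Measure.le_iff.2 fun A hA => by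
    rw [happ q hq hA]
    exact ENNReal.tsum_le_of_sum_range_le fun n => le_add_self.trans (hsum n A).2.le
  have := isFiniteMeasure_of_le _ hle1
  have := isFiniteMeasure_of_le _ hle2
  set ν₁ := μ₁ - (Measure.sum t).map p with hν₁
  set ν₂ := μ₂ - (Measure.sum t).map q with hν₂
  have e1 : ν₁ + (Measure.sum t).map p = μ₁ := sub_add_cancel_of_le hle1
  have e2 : ν₂ + (Measure.sum t).map q = μ₂ := sub_add_cancel_of_le hle2
  have := isFiniteMeasure_of_le _ (sub_le : ν₁ ≤ μ₁)
  have := isFiniteMeasure_of_le _ (sub_le : ν₂ ≤ μ₂)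
  -- The final remainders lie below the residuals of every round, since the full sum exceeds each
  -- partial sum.
  have hr1 n : ν₁ ≤ (ν n).1 := Measure.le_iff.2 fun A hA => by
    refine le_of_add_eq_add (measure_ne_top μ₁ A) ?_ (hsum n A).1 (ENNReal.sum_le_tsum _)
    rw [← happ p hp hA, ← Measure.add_apply, e1]
  have hr2 n : ν₂ ≤ (ν n).2 := Measure.le_iff.2 fun A hA => by
    refine le_of_add_eq_add (measure_ne_top μ₂ A) ?_ (hsum n A).2 (ENNReal.sum_le_tsum _)
    rw [← happ q hq hA, ← Measure.add_apply, e2]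
  -- A common part of the remainders was available for matching in every round; if nonzero, it would
  -- be counted infinitely often within the finite mass of `μ₂`.
  have hcommon : landing K q ν₁ ⊓ ν₂ = 0 := by
    rw [← Measure.measure_univ_eq_zero]
    by_contra h0
    have h1 : ∑' _ : ℕ, (landing K q ν₁ ⊓ ν₂) Set.univ ≤ μ₂ Set.univ := by
      refine le_trans (ENNReal.tsum_le_tsum fun n => ?_)
        ((happ q hq .univ).symm.le.trans (hle2 _))
      have : landing K q ν₁ ⊓ ν₂ ≤ (t n).map q :=
        (inf_le_inf (landing_mono hK hq (hr1 n)) (hr2 n)).trans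
          (map_matching_right _ _ hK hq hK1).ge
      exact this _
    rw [ENNReal.tsum_const_eq_top_of_ne_zero h0, top_le_iff] at h1
    exact measure_ne_top _ _ h1
  have := isFiniteMeasure_bind ν₁ hK hK1
  have : IsFiniteMeasure (landing K q ν₁) := by unfold landing; infer_instance
  -- Nothing from `ν₁` lands in `A`, while `ν₂` lives on `A`. The set `s` of points that reach `A`
  -- is the saturation of `A`.
  obtain ⟨A, hA, hA1, hA2⟩ := mutuallySingular_of_disjoint (disjoint_iff.2 hcommon)
  set s := {x | K x (q ⁻¹' A) ≠ 0} with hs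
  have hKA : Measurable fun x => K x (q ⁻¹' A) := (Measure.measurable_coe (hq hA)).comp hK
  have hsm : MeasurableSet s := hKA (measurableSet_singleton 0).compl
  -- On an invariant set both marginals of the matched mass coincide, so the equality of `μ₁` and
  -- `μ₂` passes to the remainders.
  have hbal (B : Set X) (hB : MeasurableSet B) (hBi : ∀ z, p z ∈ B ↔ q z ∈ B) : ν₁ B = ν₂ B := by
    have h1 : (Measure.sum t).map p B = (Measure.sum t).map q B := by
      rw [map_apply hp hB, map_apply hq hB]
      congr 1; ext z; exact hBi z
    have h2 := hinv B hB hBi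
    rw [← e1, ← e2, Measure.add_apply, Measure.add_apply, h1] at h2
    exact (ENNReal.add_left_inj (measure_ne_top _ _)).1 h2
  have hs1 : ν₁ s = 0 := by
    rw [landing, map_apply hq hA, bind_apply (hq hA) hK.aemeasurable, lintegral_eq_zero_iff hKA]
      at hA1
    exact hA1
  have hs2 : ν₂ s = 0 := (hbal s hsm (hsat A hA).2).symm.trans hs1
  have hz2 : ν₂ Set.univ = 0 := by
    rw [← Set.union_compl_self A]
    exact measure_union_null (measure_mono_null (hsat A hA).1 hs2) hA2
  have hz1 : ν₁ Set.univ = 0 := (hbal _ .univ fun z => by simp).trans hz2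
  rw [Measure.measure_univ_eq_zero] at hz1 hz2
  refine ⟨Measure.sum t, ?_, by simpa [hz1] using e1, by simpa [hz2] using e2⟩
  refine Measure.AbsolutelyContinuous.mk fun B hB h0 => ?_
  rw [sum_apply _ hB, ENNReal.tsum_eq_zero]
  intro n
  exact le_antisymm (((matching_le _ _ hK hq hK1).trans (bind_mono_left hK (hνle n).1) B).trans
    h0.le) (zero_le)

end Greedy

end Transport

/-! ### Isomorphisms of balls and their restrictions -/

section LocalIso

/-- Restriction of an isomorphism of induced subgraphs to smaller induced subgraphs. -/
def GraphIso.restrict {α β α' β' : Type} {G : Graph α β} {H : Graph α' β'} {S A : Set α}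
    {S' A' : Set α'} (φ : GraphIso (G.induce S) (H.induce S')) (hA : A ⊆ S) (hA' : A' ⊆ S')
    (h : ∀ v : V(G.induce S), v.1 ∈ A ↔ (φ.onV v).1 ∈ A') :
    GraphIso (G.induce A) (H.induce A') where
  onV :=
    { toFun v := ⟨(φ.onV ⟨v.1, hA v.2⟩).1, (h _).1 v.2⟩
      invFun w := ⟨(φ.onV.symm ⟨w.1, hA' w.2⟩).1, (h _).2 (by simpa using w.2)⟩
      left_inv v := by
        have := congrArg Subtype.val (φ.onV.symm_apply_apply ⟨v.1, hA v.2⟩)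
        exact Subtype.ext this
      right_inv w := by
        have := congrArg Subtype.val (φ.onV.apply_symm_apply ⟨w.1, hA' w.2⟩)
        exact Subtype.ext this }
  onE :=
    { toFun e := ⟨(φ.onE ⟨e.1, by
          obtain ⟨x, y, hl, hx, hy⟩ := e.2
          exact ⟨x, y, hl, hA hx, hA hy⟩⟩).1, by
        obtain ⟨x, y, hl, hx, hy⟩ := e.2
        have := (φ.isLink_iff ⟨e.1, ⟨x, y, hl, hA hx, hA hy⟩⟩ ⟨x, hA hx⟩ ⟨y, hA hy⟩).2
          ⟨hl, hA hx, hA hy⟩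
        exact ⟨_, _, this.1, (h ⟨x, hA hx⟩).1 hx, (h ⟨y, hA hy⟩).1 hy⟩⟩
      invFun e := ⟨(φ.onE.symm ⟨e.1, by
          obtain ⟨x, y, hl, hx, hy⟩ := e.2
          exact ⟨x, y, hl, hA' hx, hA' hy⟩⟩).1, by
        obtain ⟨x, y, hl, hx, hy⟩ := e.2
        have := (φ.symm.isLink_iff ⟨e.1, ⟨x, y, hl, hA' hx, hA' hy⟩⟩ ⟨x, hA' hx⟩ ⟨y, hA' hy⟩).2
          ⟨hl, hA' hx, hA' hy⟩
        refine ⟨_, _, this.1, (h _).2 ?_, (h _).2 ?_⟩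
        · simpa [GraphIso.symm] using hx
        · simpa [GraphIso.symm] using hy⟩
      left_inv e := Subtype.ext (by simp)
      right_inv e := Subtype.ext (by simp) }
  isLink_iff e x y := by
    have := φ.isLink_iff ⟨e.1, by
          obtain ⟨x, y, hl, hx, hy⟩ := e.2
          exact ⟨x, y, hl, hA hx, hA hy⟩⟩ ⟨x.1, hA x.2⟩ ⟨y.1, hA y.2⟩
    constructor
    · intro hl
      exact ⟨(this.1 ⟨hl.1, hA' hl.2.1, hA' hl.2.2⟩).1, x.2, y.2⟩
    · intro hl
      exact ⟨(this.2 ⟨hl.1, hA hl.2.1, hA hl.2.2⟩).1, (h _).1 x.2, (h _).1 y.2⟩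

variable {Ξ : Type u}

theorem MarksRelated.trans {P Q W : Ξ → Ξ → Prop} {G H K : MarkedGraph Ξ}
    {φ : GraphIso G.graph H.graph} {ψ : GraphIso H.graph K.graph}
    (hφ : MarksRelated (G := G) (H := H) P φ) (hψ : MarksRelated (G := H) (H := K) Q ψ)
    (hW : ∀ a b c, P a b → Q b c → W a c) :
    MarksRelated (G := G) (H := K) W (φ.trans ψ) :=
  ⟨fun v => hW _ _ _ (hφ.1 v) (hψ.1 _), fun v e h h' =>
    hW _ _ _ (hφ.2 v e h (φ.inc _ _ h)) (hψ.2 _ _ _ h')⟩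

theorem MarksRelated.mono {P W : Ξ → Ξ → Prop} {G H : MarkedGraph Ξ}
    {φ : GraphIso G.graph H.graph} (hφ : MarksRelated (G := G) (H := H) P φ)
    (hW : ∀ a b, P a b → W a b) : MarksRelated (G := G) (H := H) W φ :=
  ⟨fun v => hW _ _ (hφ.1 v), fun v e h h' => hW _ _ (hφ.2 v e h h')⟩

theorem Network.dist_triangle (G : Network Ξ) (u v w : G.Vert) :
    G.dist u w ≤ G.dist u v + G.dist v w :=
  G.connected.dist_triangle

theorem Network.dist_comm (G : Network Ξ) (u v : G.Vert) : G.dist u v = G.dist v u :=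
  SimpleGraph.dist_comm

theorem Network.dist_self (G : Network Ξ) (v : G.Vert) : G.dist v v = 0 :=
  SimpleGraph.dist_self

theorem Network.dist_le_one (G : Network Ξ) {u v : G.Vert} {e : G.E}
    (h : G.graph.IsLink e u.1 v.1) : G.dist u v ≤ 1 := by
  by_cases huv : u = v
  · rw [huv, G.dist_self]; exact zero_le_one
  · exact (SimpleGraph.dist_eq_one_iff_adj.2
      (show G.graph.toSimpleGraph.Adj u v from ⟨huv, e, h⟩)).le

theorem Network.exists_isLink_of_dist_eq_succ (G : Network Ξ) {p w : G.Vert} {n : ℕ}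
    (h : G.dist p w = n + 1) : ∃ (u : G.Vert) (e : G.E), G.dist p u ≤ n ∧
      G.graph.IsLink e u.1 w.1 := by
  obtain ⟨q, hq⟩ := G.connected.exists_walk_length_eq_dist w p
  have hq' : q.length = n + 1 := by rw [hq, ← h, G.dist_comm]; rfl
  have hne : w ≠ p := by
    rintro rfl
    rw [G.dist_self] at h
    omega
  obtain ⟨u, hadj, q', rfl⟩ := SimpleGraph.Walk.exists_eq_cons_of_ne hne q
  obtain ⟨e, he⟩ := hadj.2
  refine ⟨u, e, ?_, he.symm⟩
  rw [G.dist_comm]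
  refine (SimpleGraph.dist_le q').trans ?_
  rw [SimpleGraph.Walk.length_cons] at hq'
  omega

variable {G H : Network Ξ} {S : Set G.V} {S' : Set H.V}

/-- The image of a vertex under an isomorphism of induced subgraphs. -/
def imageVert (φ : GraphIso (G.graph.induce S) (H.graph.induce S')) (hS' : S' ⊆ V(H.graph))
    (v : G.Vert) (hv : v.1 ∈ S) : H.Vert :=
  ⟨(φ.onV ⟨v.1, hv⟩).1, hS' (φ.onV ⟨v.1, hv⟩).2⟩

theorem imageVert_symm (φ : GraphIso (G.graph.induce S) (H.graph.induce S'))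
    (hS : S ⊆ V(G.graph)) (hS' : S' ⊆ V(H.graph)) {v : G.Vert} {w : H.Vert} (hv : v.1 ∈ S)
    (h : imageVert φ hS' v hv = w) (hw : w.1 ∈ S') : imageVert φ.symm hS w hw = v := by
  subst h
  have := congrArg Subtype.val (φ.onV.symm_apply_apply ⟨v.1, hv⟩)
  exact Subtype.ext this

/-- Distances are those of the whole networks, not of the induced subgraphs. A geodesic from `p` to
`w` stays in the ball, hence in `S`, so its edges are mapped one by one to edges of `H`. -/
theorem dist_imageVert_le (φ : GraphIso (G.graph.induce S) (H.graph.induce S'))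
    (hS' : S' ⊆ V(H.graph)) (p : G.Vert) (hp : p.1 ∈ S) (m : ℕ)
    (hball : ∀ w : G.Vert, G.dist p w ≤ m → w.1 ∈ S) (n : ℕ) (hn : n ≤ m) (w : G.Vert)
    (hw : G.dist p w ≤ n) :
    H.dist (imageVert φ hS' p hp) (imageVert φ hS' w (hball w (hw.trans hn))) ≤ n := by
  induction n generalizing w with
  | zero =>
    have : p = w := (G.connected.dist_eq_zero_iff).1 (Nat.le_zero.1 hw)
    subst this
    exact (H.dist_self _).le
  | succ n ih =>
    rcases hw.lt_or_eq with h | h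
    · exact (ih (by omega) w (by omega)).trans (Nat.le_succ n)
    · obtain ⟨u, e, hu, he⟩ := G.exists_isLink_of_dist_eq_succ h
      have huS := hball u (hu.trans (by omega))
      have hwS := hball w (hw.trans hn)
      have hl := (φ.isLink_iff ⟨e, u.1, w.1, he, huS, hwS⟩ ⟨u.1, huS⟩ ⟨w.1, hwS⟩).2 ⟨he, huS, hwS⟩
      exact (H.dist_triangle _ (imageVert φ hS' u huS) _).trans
        (add_le_add (ih (by omega) u hu) (H.dist_le_one hl.1))

theorem mem_nbhd_iff {k : ℕ} (x : RootedNetwork Ξ k) (r : ℝ) (v : x.net.Vert) :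
    v.1 ∈ x.nbhd r ↔ ∃ i, (x.net.dist (x.root i) v : ℝ) ≤ r :=
  ⟨fun ⟨_, h⟩ => h, fun h => ⟨v.2, h⟩⟩

theorem root_mem_nbhd {k : ℕ} (x : RootedNetwork Ξ k) {r : ℝ} (hr : 0 ≤ r) (i : Fin k) :
    (x.root i).1 ∈ x.nbhd r :=
  (mem_nbhd_iff x r _).2 ⟨i, by rw [x.net.dist_self]; simpa using hr⟩

theorem image_mem_nbhd {k : ℕ} (φ : GraphIso (G.graph.induce S) (H.graph.induce S'))
    (hS' : S' ⊆ V(H.graph)) (a : Fin k → G.Vert) (b : Fin k → H.Vert) (ha : ∀ i, (a i).1 ∈ S)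
    (hab : ∀ i, imageVert φ hS' (a i) (ha i) = b i) {r : ℝ}
    (h1 : (⟨G, a⟩ : RootedNetwork Ξ k).nbhd r ⊆ S) (v : V(G.graph.induce S))
    (hv : v.1 ∈ (⟨G, a⟩ : RootedNetwork Ξ k).nbhd r) :
    (φ.onV v).1 ∈ (⟨H, b⟩ : RootedNetwork Ξ k).nbhd r := by
  obtain ⟨v, hvS⟩ := v
  obtain ⟨hvV, i, hi⟩ := hv
  refine (mem_nbhd_iff (⟨H, b⟩ : RootedNetwork Ξ k) r (imageVert φ hS' ⟨v, hvV⟩ hvS)).2 ⟨i, ?_⟩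
  have := dist_imageVert_le φ hS' (a i) (ha i) (G.dist (a i) ⟨v, hvV⟩)
    (fun w hw => h1 ⟨w.2, i, le_trans (by exact_mod_cast hw) hi⟩) _ le_rfl ⟨v, hvV⟩ le_rfl
  rw [hab] at this
  exact le_trans (by exact_mod_cast this) hi

/-- `x` and `y` agree up to radius `r`, corresponding marks being related by `P`. -/
def AgreeWith {k : ℕ} (P : Ξ → Ξ → Prop) (r : ℝ) (x y : RootedNetwork Ξ k) : Prop :=
  (∀ i j, x.net.dist (x.root i) (x.root j) = y.net.dist (y.root i) (y.root j)) ∧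
  ∃ φ : GraphIso (x.ball r).graph (y.ball r).graph,
    (∀ (i : Fin k) (v : V((x.ball r).graph)), v.1 = (x.root i).1 →
      (φ.onV v).1 = (y.root i).1) ∧
    MarksRelated (G := x.ball r) (H := y.ball r) P φ

/-- An isomorphism of induced subgraphs that contain the `r`-balls around the roots restricts to an
isomorphism of these balls. -/
theorem AgreeWith.of_iso {k : ℕ} {P : Ξ → Ξ → Prop}
    (φ : GraphIso (G.graph.induce S) (H.graph.induce S'))
    (hS : S ⊆ V(G.graph)) (hS' : S' ⊆ V(H.graph))
    (hφ : MarksRelated (G := G.toMarkedGraph.induce S hS) (H := H.toMarkedGraph.induce S' hS') P φ)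
    (a : Fin k → G.Vert) (b : Fin k → H.Vert) (ha : ∀ i, (a i).1 ∈ S)
    (hab : ∀ i, imageVert φ hS' (a i) (ha i) = b i) {r : ℝ}
    (h1 : (⟨G, a⟩ : RootedNetwork Ξ k).nbhd r ⊆ S) (h2 : (⟨H, b⟩ : RootedNetwork Ξ k).nbhd r ⊆ S')
    (hd : ∀ i j, G.dist (a i) (a j) = H.dist (b i) (b j)) :
    AgreeWith P r (⟨G, a⟩ : RootedNetwork Ξ k) ⟨H, b⟩ := by
  have hb i : (b i).1 ∈ S' := by rw [← hab i]; exact (φ.onV _).2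
  have hba i : imageVert φ.symm hS (b i) (hb i) = a i :=
    imageVert_symm φ hS hS' (ha i) (hab i) _
  -- Distances to the roots do not increase under `φ` nor under its inverse, so the two balls
  -- correspond exactly.
  have key (v : V(G.graph.induce S)) : v.1 ∈ (⟨G, a⟩ : RootedNetwork Ξ k).nbhd r ↔
      (φ.onV v).1 ∈ (⟨H, b⟩ : RootedNetwork Ξ k).nbhd r := by
    refine ⟨image_mem_nbhd φ hS' a b ha hab h1 v, fun h => ?_⟩
    have := image_mem_nbhd φ.symm hS b a hb hba h2 (φ.onV v) h
    rwa [show φ.symm.onV (φ.onV v) = v from φ.onV.symm_apply_apply v] at this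
  refine ⟨hd, φ.restrict h1 h2 key, fun i v hv => ?_, fun v => hφ.1 ⟨v.1, h1 v.2⟩,
    fun v e h h' => ?_⟩
  · have h := congrArg Subtype.val (hab i)
    rw [← h]
    exact congrArg (fun w => (φ.onV w).1) (Subtype.ext hv)
  · exact hφ.2 ⟨v.1, h1 v.2⟩ ⟨e.1, _⟩ (h.imp fun _ hy => ⟨hy.1, h1 hy.2.1, h1 hy.2.2⟩)
      (h'.imp fun _ hy => ⟨hy.1, h2 hy.2.1, h2 hy.2.2⟩)

variable {k : ℕ} {x y z : RootedNetwork Ξ k} {P Q W : Ξ → Ξ → Prop} {r s : ℝ}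

theorem RootedNetwork.nbhd_mono (x : RootedNetwork Ξ k) (h : s ≤ r) : x.nbhd s ⊆ x.nbhd r :=
  fun _ ⟨hv, i, hi⟩ => ⟨hv, i, hi.trans h⟩

theorem AgreeWith.reroot {m : ℕ} (hr : 0 ≤ r) (f : Fin m → Fin k) (h : AgreeWith P r x y) :
    AgreeWith P r (⟨x.net, x.root ∘ f⟩ : RootedNetwork Ξ m) ⟨y.net, y.root ∘ f⟩ := by
  obtain ⟨hd, φ, hroot, hφ⟩ := h
  exact .of_iso φ (x.nbhd_subset r) (y.nbhd_subset r) hφ _ _ (fun i => root_mem_nbhd x hr (f i))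
    (fun i => Subtype.ext (hroot (f i) _ rfl)) (fun v ⟨hv, i, hi⟩ => ⟨hv, f i, hi⟩)
    (fun v ⟨hv, i, hi⟩ => ⟨hv, f i, hi⟩) (fun i j => hd _ _)

theorem AgreeWith.mono (hs : 0 ≤ s) (hsr : s ≤ r) (hW : ∀ a b, P a b → W a b)
    (h : AgreeWith P r x y) : AgreeWith W s x y := by
  obtain ⟨hd, φ, hroot, hφ⟩ := h
  exact .of_iso φ (x.nbhd_subset r) (y.nbhd_subset r) (hφ.mono hW) _ _
    (fun i => root_mem_nbhd x (hs.trans hsr) i)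
    (fun i => Subtype.ext (hroot i _ rfl)) (x.nbhd_mono hsr) (y.nbhd_mono hsr) hd

theorem AgreeWith.trans (hW : ∀ a b c, P a b → Q b c → W a c)
    (h : AgreeWith P r x y) (h' : AgreeWith Q r y z) : AgreeWith W r x z := by
  obtain ⟨hd, φ, hroot, hφ⟩ := h
  obtain ⟨hd', ψ, hroot', hψ⟩ := h'
  exact ⟨fun i j => (hd i j).trans (hd' i j), φ.trans ψ,
    fun i v hv => hroot' i _ (hroot i v hv), hφ.trans hψ hW⟩

/-- An isomorphism of graphs as an isomorphism of the subgraphs induced on all vertices. -/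
def GraphIso.toInduce {α β α' β' : Type} {G : Graph α β} {H : Graph α' β'} (φ : GraphIso G H) :
    GraphIso (G.induce V(G)) (H.induce V(H)) where
  onV := φ.onV
  onE := (Equiv.setCongr (by rw [Graph.induce_vertexSet])).trans
    (φ.onE.trans (Equiv.setCongr (by rw [Graph.induce_vertexSet])))
  isLink_iff e x y := by
    have he : e.1 ∈ E(G) := by
      obtain ⟨a, b, h, -⟩ := e.2
      exact h.edge_mem
    have := φ.isLink_iff ⟨e.1, he⟩ x y
    exact ⟨fun h => ⟨this.1 h.1, x.2, y.2⟩, fun h => ⟨this.2 h.1, (φ.onV x).2, (φ.onV y).2⟩⟩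

theorem AgreeWith.of_rel (hW : ∀ a, W a a) (h : (rootedSetoid Ξ k).r x y) :
    AgreeWith W r x y := by
  obtain ⟨φ, hroot⟩ := h
  obtain ⟨G, a⟩ := x
  obtain ⟨H, b⟩ := y
  have hφ : MarksRelated (G := G.toMarkedGraph.induce V(G.graph) subset_rfl)
      (H := H.toMarkedGraph.induce V(H.graph) subset_rfl) W φ.toGraphIso.toInduce := by
    refine ⟨fun v => ?_, fun v e h h' => ?_⟩
    · have := φ.marks.1 v
      exact this ▸ hW _
    · obtain ⟨w, hw, -⟩ := h
      obtain ⟨w', hw', -⟩ := h'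
      have := φ.marks.2 v ⟨e.1, hw.edge_mem⟩ ⟨w, hw⟩ ⟨w', hw'⟩
      exact this ▸ hW _
  have hle (G H : Network Ξ) (φ : NetworkIso G H) (p w : G.Vert) :
      H.dist (φ.onV p) (φ.onV w) ≤ G.dist p w :=
    dist_imageVert_le φ.toGraphIso.toInduce subset_rfl p p.2 (G.dist p w) (fun w _ => w.2) _ le_rfl
      w le_rfl
  refine .of_iso φ.toGraphIso.toInduce subset_rfl subset_rfl hφ a b (fun i => (a i).2) hroot
    (fun v hv => hv.1) (fun v hv => hv.1) fun i j => le_antisymm ?_ ?_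
  · have := hle H G φ.symm (φ.onV (a i)) (φ.onV (a j))
    simp only [show φ.symm.onV = φ.onV.symm from rfl, Equiv.symm_apply_apply] at this
    rwa [hroot i, hroot j] at this
  · have := hle G H φ (a i) (a j)
    rwa [hroot i, hroot j] at this

/-- If two rooted networks agree up to a large radius, then the vertices close to the root of the
first can be mapped to the second so that the doubly-rooted networks agree. -/
theorem AgreeWith.exists_addRoot {o : G.Vert} {o' : H.Vert} {R : ℝ} {n : ℕ} (hr : 0 ≤ r)
    (hR : n + r ≤ R) (h : AgreeWith P R (⟨G, ![o]⟩ : RootedNetwork Ξ 1) ⟨H, ![o']⟩) :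
    ∃ f : {v : G.Vert // G.dist o v ≤ n} → {w : H.Vert // H.dist o' w ≤ n}, f.Injective ∧
      ∀ v, AgreeWith P r (⟨G, ![o, v.1]⟩ : RootedNetwork Ξ 2) ⟨H, ![o', (f v).1]⟩ := by
  obtain ⟨-, φ, hroot, hφ⟩ := h
  have hn0 : (0 : ℝ) ≤ n := n.cast_nonneg
  have hR0 : 0 ≤ R := by linarith
  have hS := (⟨G, ![o]⟩ : RootedNetwork Ξ 1).nbhd_subset R
  have hS' := (⟨H, ![o']⟩ : RootedNetwork Ξ 1).nbhd_subset R
  have hmem (K : Network Ξ) (p w : K.Vert) :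
      w.1 ∈ (⟨K, ![p]⟩ : RootedNetwork Ξ 1).nbhd R ↔ (K.dist p w : ℝ) ≤ R := by
    rw [mem_nbhd_iff]; simp
  have hmem' (K : Network Ξ) (p w : K.Vert) (hw : K.dist p w ≤ n) :
      w.1 ∈ (⟨K, ![p]⟩ : RootedNetwork Ξ 1).nbhd R :=
    (hmem K p w).2 (le_trans (by exact_mod_cast hw) (by linarith : (n : ℝ) ≤ R))
  have ho : o.1 ∈ (⟨G, ![o]⟩ : RootedNetwork Ξ 1).nbhd R := root_mem_nbhd _ hR0 0
  have hoo : imageVert φ hS' o ho = o' := Subtype.ext (hroot 0 ⟨o.1, ho⟩ rfl)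
  have hle (v : G.Vert) (hv : G.dist o v ≤ n) :
      H.dist o' (imageVert φ hS' v (hmem' G o v hv)) ≤ G.dist o v := by
    have := dist_imageVert_le φ hS' o ho n (fun w hw => hmem' G o w hw) (G.dist o v) hv v le_rfl
    rwa [hoo] at this
  have ho' : o'.1 ∈ (⟨H, ![o']⟩ : RootedNetwork Ξ 1).nbhd R := root_mem_nbhd _ hR0 0
  have hoo' : imageVert φ.symm hS o' ho' = o := imageVert_symm φ hS hS' ho hoo _
  -- The inverse gives the reverse inequality; `hle` is what keeps the image within distance `n`,
  -- where the inverse is under control.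
  have hge (v : G.Vert) (hv : G.dist o v ≤ n) :
      G.dist o v ≤ H.dist o' (imageVert φ hS' v (hmem' G o v hv)) := by
    set w := imageVert φ hS' v (hmem' G o v hv) with hw
    have := dist_imageVert_le φ.symm hS o' ho' n (fun w hw => hmem' H o' w hw) (H.dist o' w)
      ((hle v hv).trans hv) w le_rfl
    rw [hoo'] at this
    have e := imageVert_symm φ hS hS' (hmem' G o v hv) hw.symm
      (hmem' H o' w ((hle v hv).trans hv))
    exact (congrArg (fun u => G.dist o u) e).ge.trans this
  refine ⟨fun v => ⟨imageVert φ hS' v.1 (hmem' G o v.1 v.2), (hle v.1 v.2).trans v.2⟩, ?_, ?_⟩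
  · intro v w hvw
    have h1 := congrArg (fun u => u.1.1) hvw
    have h2 := φ.onV.injective (Subtype.ext h1)
    exact Subtype.ext (Subtype.ext (congrArg (fun u => u.1) h2))
  · rintro ⟨v, hv⟩
    -- This is where `n + r ≤ R` enters: the `r`-balls around both roots fit into the `R`-ball
    -- around the first.
    have hsub (K : Network Ξ) (p q : K.Vert) (hpq : K.dist p q ≤ n) :
        (⟨K, ![p, q]⟩ : RootedNetwork Ξ 2).nbhd r ⊆ (⟨K, ![p]⟩ : RootedNetwork Ξ 1).nbhd R := by
      rintro w ⟨hw, i, hi⟩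
      refine (hmem K p ⟨w, hw⟩).2 ?_
      fin_cases i
      · exact le_trans hi (by linarith)
      · have h1 : (K.dist p ⟨w, hw⟩ : ℝ) ≤ K.dist p q + K.dist q ⟨w, hw⟩ := by
          exact_mod_cast K.dist_triangle p q ⟨w, hw⟩
        have h2 : (K.dist p q : ℝ) ≤ n := by exact_mod_cast hpq
        have h3 : (K.dist q ⟨w, hw⟩ : ℝ) ≤ r := hi
        linarith
    have hd := le_antisymm (hge v hv) (hle v hv)
    refine .of_iso φ hS hS' hφ _ _ ?_ ?_ (hsub G o v hv) (hsub H o' _ ((hle v hv).trans hv)) ?_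
    · intro i
      fin_cases i
      · exact ho
      · exact hmem' G o v hv
    · intro i
      fin_cases i
      · exact hoo
      · rfl
    · intro i j
      fin_cases i <;> fin_cases j
      · exact (G.dist_self _).trans (H.dist_self _).symm
      · exact hd
      · exact (G.dist_comm _ _).trans (hd.trans (H.dist_comm _ _))
      · exact (G.dist_self _).trans (H.dist_self _).symm

end LocalIso

/-! ### Sums over the second root and the local topology -/

section LocalTopology

variable {Ξ : Type u}

theorem RootedClass.exists_rep {k : ℕ} (a : RootedClass Ξ k) : ∃ x : RootedNetwork Ξ k, x.cls = a :=
  Quotient.exists_rep a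

theorem GStar.exists_rep (a : GStar Ξ) : ∃ (G : Network Ξ) (o : G.Vert), G.cls₁ o = a := by
  obtain ⟨⟨G, o⟩, rfl⟩ := RootedClass.exists_rep a
  refine ⟨G, o 0, congrArg (fun r : Fin 1 → G.Vert => RootedNetwork.cls ⟨G, r⟩) (funext fun i => ?_)⟩
  fin_cases i; rfl

theorem GStarStar.exists_rep (a : GStarStar Ξ) :
    ∃ (G : Network Ξ) (o v : G.Vert), G.cls₂ o v = a := by
  obtain ⟨⟨G, o⟩, rfl⟩ := RootedClass.exists_rep a
  refine ⟨G, o 0, o 1,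
    congrArg (fun r : Fin 2 → G.Vert => RootedNetwork.cls ⟨G, r⟩) (funext fun i => ?_)⟩
  fin_cases i <;> rfl

theorem Network.finite_dist_le (G : Network Ξ) (o : G.Vert) (n : ℕ) :
    {v : G.Vert | G.dist o v ≤ n}.Finite := by
  induction n with
  | zero =>
    refine (Set.finite_singleton o).subset fun v hv => ?_
    exact ((G.connected.dist_eq_zero_iff).1 (Nat.le_zero.1 hv)).symm
  | succ n ih =>
    have h1 : (⋃ u ∈ {v : G.Vert | G.dist o v ≤ n}, ⋃ e ∈ {e | G.graph.Inc e u.1},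
        {w : G.Vert | G.graph.IsLink e u.1 w.1}).Finite := by
      refine ih.biUnion fun u _ => (G.locallyFinite u.1 u.2).biUnion fun e _ => ?_
      refine Set.Subsingleton.finite fun w hw w' hw' => Subtype.ext ?_
      exact Graph.IsLink.right_unique hw hw'
    refine (ih.union h1).subset fun w hw => ?_
    rcases (show G.dist o w ≤ n + 1 from hw).lt_or_eq with h | h
    · exact Or.inl (Nat.lt_succ_iff.1 h)
    · obtain ⟨u, e, hu, he⟩ := G.exists_isLink_of_dist_eq_succ h
      refine Or.inr ?_
      simp only [Set.mem_iUnion]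
      exact ⟨u, hu, e, he.inc_left, he⟩

/-- The distance of the two roots. -/
def rootDist : GStarStar Ξ → ℕ :=
  Quotient.lift (s := rootedSetoid Ξ 2) (fun x => x.net.dist (x.root 0) (x.root 1))
    fun _ _ h => (AgreeWith.of_rel (W := fun _ _ => True) (r := 0) (fun _ => trivial) h).1 0 1

section Sum

theorem sumSecondRoot_ext {f g : GStarStar Ξ → ℝ≥0∞} {x : GStar Ξ}
    (h : ∀ z, proj₁ z = x → f z = g z) : sumSecondRoot f x = sumSecondRoot g x := by
  obtain ⟨G, o, rfl⟩ := GStar.exists_rep x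
  exact tsum_congr fun v => h _ (proj₁_cls₂ G o v)

theorem sumSecondRoot_tsum {ι : Type*} (f : ι → GStarStar Ξ → ℝ≥0∞) (x : GStar Ξ) :
    sumSecondRoot (fun z => ∑' i, f i z) x = ∑' i, sumSecondRoot (f i) x := by
  obtain ⟨G, o, rfl⟩ := GStar.exists_rep x
  simp only [sumSecondRoot_cls₁]
  exact ENNReal.tsum_comm

theorem sumSecondRoot_const_mul (c : ℝ≥0∞) (f : GStarStar Ξ → ℝ≥0∞) (x : GStar Ξ) :
    sumSecondRoot (fun z => c * f z) x = c * sumSecondRoot f x := by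
  obtain ⟨G, o, rfl⟩ := GStar.exists_rep x
  exact ENNReal.tsum_mul_left

theorem sumSecondRoot_proj₁_mul (c : GStar Ξ → ℝ≥0∞) (f : GStarStar Ξ → ℝ≥0∞) (x : GStar Ξ) :
    sumSecondRoot (fun z => c (proj₁ z) * f z) x = c x * sumSecondRoot f x := by
  rw [← sumSecondRoot_const_mul]
  exact sumSecondRoot_ext fun z hz => by rw [hz]

theorem sumSecondRoot_eq_zero_iff (f : GStarStar Ξ → ℝ≥0∞) (x : GStar Ξ) :
    sumSecondRoot f x = 0 ↔ ∀ z, proj₁ z = x → f z = 0 := by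
  constructor
  · intro h z hz
    obtain ⟨G, o, v, rfl⟩ := GStarStar.exists_rep z
    rw [proj₁_cls₂] at hz
    subst hz
    rw [sumSecondRoot_cls₁, ENNReal.tsum_eq_zero] at h
    exact h v
  · intro h
    rw [sumSecondRoot_ext (g := fun _ => 0) h]
    obtain ⟨G, o, rfl⟩ := GStar.exists_rep x
    simp [sumSecondRoot_cls₁]

/-- Balls are finite. Finiteness of these counts is what permits subtraction when passing to
complements. -/
theorem sumSecondRoot_indicator_lt_top (n : ℕ) {A : Set (GStarStar Ξ)}
    (hA : ∀ z ∈ A, rootDist z ≤ n) (x : GStar Ξ) :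
    sumSecondRoot (A.indicator 1) x < ∞ := by
  obtain ⟨G, o, rfl⟩ := GStar.exists_rep x
  have hfin := G.finite_dist_le o n
  rw [sumSecondRoot_cls₁, tsum_eq_sum (s := hfin.toFinset)]
  · refine ENNReal.sum_lt_top.2 fun v _ => ?_
    refine lt_of_le_of_lt (Set.indicator_le_self' (fun _ _ => zero_le_one) _) ENNReal.one_lt_top
  · intro v hv
    refine Set.indicator_of_notMem (fun h => hv ?_) _
    exact hfin.mem_toFinset.2 (hA _ h)

end Sum

variable [MetricSpace Ξ] {k : ℕ}

/-- Representatives of `a` and `b` agree up to radius `r`. -/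
def Near (r : ℝ) (a b : RootedClass Ξ k) : Prop :=
  ∃ x y : RootedNetwork Ξ k, x.cls = a ∧ y.cls = b ∧ x.Agree r y

theorem agree_iff_agreeWith {r : ℝ} {x y : RootedNetwork Ξ k} :
    x.Agree r y ↔ AgreeWith (fun a b => dist a b < 1 / r) r x y := Iff.rfl

/-- Composition with isomorphisms, which relate marks by equality, moves the agreement to any chosen
representatives at no cost in radius or tolerance. -/
theorem Near.agree {r : ℝ} {x y : RootedNetwork Ξ k} (h : Near r x.cls y.cls) :
    x.Agree r y := by
  obtain ⟨x', y', hx, hy, h⟩ := h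
  have h1 : AgreeWith Eq r x x' := .of_rel (fun _ => rfl) (Quotient.exact hx.symm)
  have h2 : AgreeWith Eq r y' y := .of_rel (fun _ => rfl) (Quotient.exact hy)
  have h3 : AgreeWith (fun a b => dist a b < 1 / r) r x y' :=
    h1.trans (fun a b c hab hbc => by rw [hab]; exact hbc) h
  exact h3.trans (fun a b c hab hbc => by rw [← hbc]; exact hab) h2

theorem Near.of_agree {r : ℝ} {x y : RootedNetwork Ξ k} (h : x.Agree r y) : Near r x.cls y.cls :=
  ⟨x, y, rfl, rfl, h⟩

variable {r s t : ℝ} {a b c : RootedClass Ξ k}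

theorem Near.refl (hr : 0 < r) (a : RootedClass Ξ k) : Near r a a := by
  obtain ⟨x, rfl⟩ := RootedClass.exists_rep a
  exact .of_agree (AgreeWith.of_rel (fun _ => by rw [dist_self]; positivity) (Setoid.refl' _ x))

theorem Near.mono (hs : 0 < s) (hsr : s ≤ r) (h : Near r a b) : Near s a b := by
  obtain ⟨x, y, rfl, rfl, h⟩ := h
  exact .of_agree (AgreeWith.mono hs.le hsr
    (fun a b hab => hab.trans_le (one_div_le_one_div_of_le hs hsr)) h)

/-- The mark tolerances `1 / r` and `1 / s` add up by the triangle inequality, and their sum has to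
fit into `1 / t`. -/
theorem Near.trans (ht : 0 < t) (htr : t ≤ r) (hts : t ≤ s) (hrst : 1 / r + 1 / s ≤ 1 / t)
    (h : Near r a b) (h' : Near s b c) : Near t a c := by
  obtain ⟨x, rfl⟩ := RootedClass.exists_rep a
  obtain ⟨y, rfl⟩ := RootedClass.exists_rep b
  obtain ⟨z, rfl⟩ := RootedClass.exists_rep c
  have h1 : AgreeWith (fun a b => dist a b < 1 / r) t x y :=
    AgreeWith.mono ht.le htr (fun _ _ h => h) h.agree
  have h2 : AgreeWith (fun a b => dist a b < 1 / s) t y z :=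
    AgreeWith.mono ht.le hts (fun _ _ h => h) h'.agree
  exact .of_agree (h1.trans (fun a b c hab hbc => by
    have := dist_triangle a b c
    linarith) h2)

theorem Near.reroot {m : ℕ} (hr : 0 ≤ r) (f : Fin m → Fin k) (h : Near r a b) :
    Near r (a.reroot f) (b.reroot f) := by
  obtain ⟨x, y, rfl, rfl, h⟩ := h
  exact .of_agree (AgreeWith.reroot hr f h)

theorem Near.rootDist_eq {a b : GStarStar Ξ} (h : Near r a b) : rootDist a = rootDist b := by
  obtain ⟨x, y, rfl, rfl, h⟩ := h
  exact h.1 0 1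

theorem distance_le_of_near (hr : 0 < r) (h : Near r a b) :
    a.distance b ≤ (1 + ENNReal.ofReal r)⁻¹ := by
  refine ENNReal.inv_le_inv.2 (by gcongr; exact le_iSup₂_of_le r ⟨hr, h⟩ le_rfl)

theorem near_of_distance_lt (hr : 0 < r) (h : a.distance b < (1 + ENNReal.ofReal r)⁻¹) :
    Near r a b := by
  have h1 := ENNReal.inv_lt_inv.1 h
  have h2 := lt_of_add_lt_add_left h1
  simp only [lt_iSup_iff] at h2
  obtain ⟨s, ⟨hs, hn⟩, hrs⟩ := h2
  exact Near.mono hr (ENNReal.ofReal_lt_ofReal_iff hs |>.1 hrs).le hn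

/-- The bound `t ≤ 1` is essential: classes that agree up to no positive radius have distance `1`,
so beyond `1` the inequality gives no radius. -/
theorem exists_near_of_distance_lt {t : ℝ≥0∞} (ht : t ≤ 1) (h : a.distance b < t) :
    ∃ r > 0, Near r a b ∧ (1 + ENNReal.ofReal r)⁻¹ < t := by
  have h1 : t⁻¹ < 1 + ⨆ r ∈ {r : ℝ | 0 < r ∧ Near r a b}, ENNReal.ofReal r :=
    ENNReal.inv_lt_iff_inv_lt.1 h
  have ht1 : 1 ≤ t⁻¹ := ENNReal.one_le_inv.2 ht
  have h2 : t⁻¹ - 1 < ⨆ r ∈ {r : ℝ | 0 < r ∧ Near r a b}, ENNReal.ofReal r :=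
    (ENNReal.sub_lt_iff_lt_left ENNReal.one_ne_top ht1).2 h1
  simp only [lt_iSup_iff] at h2
  obtain ⟨s, ⟨hs, hn⟩, hrs⟩ := h2
  refine ⟨s, hs, hn, ENNReal.inv_lt_iff_inv_lt.1 ?_⟩
  exact (ENNReal.sub_lt_iff_lt_left ENNReal.one_ne_top ht1).1 hrs

theorem exists_lt_of_inv_lt {t : ℝ≥0∞} (hr : 0 < r) (h : (1 + ENNReal.ofReal r)⁻¹ < t) :
    ∃ s, 0 < s ∧ s < r ∧ (1 + ENNReal.ofReal s)⁻¹ < t := by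
  have hc : Continuous fun s : ℝ => (1 + ENNReal.ofReal s)⁻¹ :=
    (continuous_const.add ENNReal.continuous_ofReal).inv
  have h1 : ∀ᶠ s in nhdsWithin r (Set.Iio r), (1 + ENNReal.ofReal s)⁻¹ < t :=
    nhdsWithin_le_nhds (hc.continuousAt.eventually_lt_const h)
  obtain ⟨s, hs, hs'⟩ := (h1.and (Ioo_mem_nhdsLT hr)).exists
  exact ⟨s, hs'.1, hs'.2, hs⟩

/-- The topology is only generated by the balls of `distance`. This reduces every topological
argument to agreement up to a radius, and rests on the quasi-triangle inequality `Near.trans`. -/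
theorem isOpen_iff_near {U : Set (RootedClass Ξ k)} :
    IsOpen U ↔ ∀ a ∈ U, ∃ r > 0, ∀ b, Near r a b → b ∈ U := by
  constructor
  · intro hU
    induction hU with
    | basic U hU =>
      obtain ⟨a, t, rfl⟩ := hU
      intro b hb
      rcases le_or_gt t 1 with ht | ht
      · obtain ⟨r, hr, hn, hrt⟩ := exists_near_of_distance_lt ht hb
        obtain ⟨s, hs, hsr, hst⟩ := exists_lt_of_inv_lt hr hrt
        -- Lowering the radius from `r` to `s` loosens the mark tolerance by `1 / s - 1 / r`; this
        -- slack is available for the agreement of `b` with `c`.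
        have hpos : 0 < 1 / s - 1 / r := sub_pos.2 (one_div_lt_one_div_of_lt hs hsr)
        have hle : s ≤ (1 / s - 1 / r)⁻¹ := by
          rw [le_inv_comm₀ hs hpos, inv_eq_one_div]
          have : 0 < 1 / r := by positivity
          linarith
        refine ⟨(1 / s - 1 / r)⁻¹, inv_pos.2 hpos, fun c hc => ?_⟩
        refine lt_of_le_of_lt (distance_le_of_near hs (hn.trans hs hsr.le hle ?_ hc)) hst
        rw [one_div (_⁻¹), inv_inv]
        linarith
      · exact ⟨1, one_pos, fun c _ => lt_of_le_of_lt (ENNReal.inv_le_one.2 le_self_add) ht⟩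
    | univ => exact fun _ _ => ⟨1, one_pos, fun _ _ => trivial⟩
    | inter U V _ _ hU hV =>
      intro a ha
      obtain ⟨r, hr, hrU⟩ := hU a ha.1
      obtain ⟨s, hs, hsV⟩ := hV a ha.2
      exact ⟨max r s, lt_max_of_lt_left hr, fun b hb =>
        ⟨hrU b (hb.mono hr (le_max_left _ _)), hsV b (hb.mono hs (le_max_right _ _))⟩⟩
    | sUnion S _ ih =>
      rintro a ⟨U, hU, ha⟩
      obtain ⟨r, hr, h⟩ := ih U hU a ha
      exact ⟨r, hr, fun b hb => ⟨U, hU, h b hb⟩⟩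
  · intro h
    choose! r hr h using h
    have : U = ⋃ a ∈ U, {b | a.distance b < (1 + ENNReal.ofReal (r a))⁻¹} := by
      refine Set.Subset.antisymm (fun a ha => Set.mem_biUnion ha ?_)
        (Set.iUnion₂_subset fun a ha b hb => h a ha b (near_of_distance_lt (hr a ha) hb))
      -- A class agrees with itself up to every radius; the radius `r a + 1` gives the strict
      -- inequality.
      have hra := hr a ha
      refine lt_of_le_of_lt (distance_le_of_near (by positivity : 0 < r a + 1)
        (Near.refl (by positivity) a)) (ENNReal.inv_lt_inv.2 ?_)
      refine ENNReal.add_lt_add_left ENNReal.one_ne_top ?_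
      exact (ENNReal.ofReal_lt_ofReal_iff (by positivity)).2 (by linarith)
    rw [this]
    exact isOpen_biUnion fun a _ => TopologicalSpace.isOpen_generateFrom_of_mem ⟨a, _, rfl⟩

theorem continuous_reroot {m : ℕ} (f : Fin m → Fin k) :
    Continuous (RootedClass.reroot f : RootedClass Ξ k → RootedClass Ξ m) := by
  refine ⟨fun U hU => isOpen_iff_near.2 fun a ha => ?_⟩
  obtain ⟨r, hr, h⟩ := isOpen_iff_near.1 hU _ ha
  exact ⟨r, hr, fun b hb => h _ (hb.reroot hr.le f)⟩

theorem measurable_proj₁ : Measurable (proj₁ : GStarStar Ξ → GStar Ξ) :=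
  (continuous_reroot _).measurable

theorem measurable_proj₂ : Measurable (proj₂ : GStarStar Ξ → GStar Ξ) :=
  (continuous_reroot _).measurable

theorem isOpen_rootDist_preimage (s : Set ℕ) : IsOpen (rootDist ⁻¹' s : Set (GStarStar Ξ)) :=
  isOpen_iff_near.2 fun a ha => ⟨1, one_pos, fun b hb => by
    rwa [Set.mem_preimage, ← hb.rootDist_eq]⟩

theorem measurable_rootDist : Measurable (rootDist : GStarStar Ξ → ℕ) :=
  fun s _ => (isOpen_rootDist_preimage s).measurableSet

theorem measurable_forget : Measurable (forget : GStar Ξ → UnrootedClass Ξ) :=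
  fun _ h => h

/-- The number of second roots in an open set, at bounded distance from the first root, is lower
semicontinuous. -/
theorem exists_near_sumSecondRoot_le {U : Set (GStarStar Ξ)} (hU : IsOpen U) (n : ℕ)
    (hn : ∀ z ∈ U, rootDist z ≤ n) (x : GStar Ξ) :
    ∃ r > 0, ∀ y, Near r x y →
      sumSecondRoot (U.indicator 1) x ≤ sumSecondRoot (U.indicator 1) y := by
  obtain ⟨G, o, rfl⟩ := GStar.exists_rep x
  have h1 (v : G.Vert) : ∃ r > 0, G.cls₂ o v ∈ U → ∀ b, Near r (G.cls₂ o v) b → b ∈ U := by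
    by_cases hv : G.cls₂ o v ∈ U
    · obtain ⟨r, hr, h⟩ := isOpen_iff_near.1 hU _ hv
      exact ⟨r, hr, fun _ => h⟩
    · exact ⟨1, one_pos, fun h => absurd h hv⟩
  choose ρ hρ hρU using h1
  -- Only the finitely many vertices within distance `n` count, so one `r` serves them all;
  -- agreement up to `n + r` at the root then carries the `r`-balls around them.
  obtain ⟨r, hr⟩ := ((G.finite_dist_le o n).image ρ).bddAbove
  have hr' (v : G.Vert) (hv : G.dist o v ≤ n) : ρ v ≤ r := hr ⟨v, hv, rfl⟩
  have hrpos : 0 < r := (hρ o).trans_le (hr' o (by rw [G.dist_self]; exact Nat.zero_le n))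
  refine ⟨n + r, by positivity, fun y hy => ?_⟩
  obtain ⟨H, o', rfl⟩ := GStar.exists_rep y
  obtain ⟨f, hf, hfa⟩ := AgreeWith.exists_addRoot hrpos.le le_rfl hy.agree
  have hsub (K : Network Ξ) (p : K.Vert) :
      sumSecondRoot (U.indicator 1) (K.cls₁ p) =
        ∑' v : {v : K.Vert | K.dist p v ≤ n}, U.indicator 1 (K.cls₂ p v) := by
    rw [sumSecondRoot_cls₁]
    refine (tsum_subtype_eq_of_support_subset (f := fun v => U.indicator 1 (K.cls₂ p v))
      fun v hv => ?_).symm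
    exact hn _ (Set.mem_of_indicator_ne_zero hv)
  rw [hsub, hsub]
  refine le_trans (ENNReal.tsum_le_tsum fun v => ?_) (ENNReal.tsum_comp_le_tsum_of_injective hf _)
  by_cases hv : G.cls₂ o v.1 ∈ U
  · have h1 : AgreeWith (fun a b => dist a b < 1 / ρ v.1) (ρ v.1)
        (⟨G, ![o, v.1]⟩ : RootedNetwork Ξ 2) ⟨H, ![o', (f v).1]⟩ :=
      (hfa v).mono (hρ v.1).le (hr' v.1 v.2) fun a b hab => hab.trans_le
        (one_div_le_one_div_of_le (hρ v.1) ((hr' v.1 v.2).trans (by simp)))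
    have h2 : H.cls₂ o' (f v).1 ∈ U := hρU v.1 hv _ (Near.of_agree h1)
    rw [Set.indicator_of_mem hv, Set.indicator_of_mem h2]
    exact le_rfl
  · rw [Set.indicator_of_notMem hv]
    exact zero_le

/-- Near `x` the count is at least its value at `x`, so even the closed superlevel conditions `c ≤
f` define open sets. -/
theorem measurable_sumSecondRoot_indicator_open {U : Set (GStarStar Ξ)} (hU : IsOpen U) (n : ℕ)
    (hn : ∀ z ∈ U, rootDist z ≤ n) : Measurable (sumSecondRoot (U.indicator 1)) := by
  refine measurable_of_Ici fun c => (isOpen_iff_near.2 fun x hx => ?_).measurableSet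
  obtain ⟨r, hr, h⟩ := exists_near_sumSecondRoot_le hU n hn x
  exact ⟨r, hr, fun y hy => le_trans hx (h y hy)⟩

/-- Dynkin's theorem, starting from the open sets. Fixing the distance of the roots keeps the counts
finite, as the complement case requires. -/
theorem measurable_sumSecondRoot_indicator_inter (n : ℕ) {A : Set (GStarStar Ξ)}
    (hA : MeasurableSet A) :
    Measurable (sumSecondRoot ((A ∩ rootDist ⁻¹' {n}).indicator 1)) := by
  have hD (A : Set (GStarStar Ξ)) : ∀ z ∈ A ∩ rootDist ⁻¹' {n}, rootDist z ≤ n :=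
    fun z hz => le_of_eq hz.2
  induction A, hA using MeasurableSpace.induction_on_inter
    (BorelSpace.measurable_eq (α := GStarStar Ξ)) isPiSystem_isOpen with
  | empty => exact measurable_sumSecondRoot_indicator_open (by simp) n (by simp)
  | basic U hU =>
    exact measurable_sumSecondRoot_indicator_open
      (IsOpen.inter hU (isOpen_rootDist_preimage _)) n (hD U)
  | compl A hA ih =>
    have huniv := measurable_sumSecondRoot_indicator_open
      (isOpen_univ.inter (isOpen_rootDist_preimage (Ξ := Ξ) {n})) n (hD _)
    convert huniv.sub ih using 1
    funext x
    obtain ⟨G, o, rfl⟩ := GStar.exists_rep x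
    rw [Pi.sub_apply]
    refine ENNReal.eq_sub_of_add_eq (sumSecondRoot_indicator_lt_top n (hD A) _).ne ?_
    simp only [sumSecondRoot_cls₁]
    rw [← ENNReal.tsum_add]
    refine tsum_congr fun v => ?_
    by_cases h1 : G.cls₂ o v ∈ A <;> by_cases h2 : rootDist (G.cls₂ o v) = n <;>
      simp [Set.indicator, h1, h2]
  | iUnion f hd hf ih =>
    have h := Measurable.tsum (L := .unconditional ℕ) ih
    convert h using 1
    funext x
    rw [← sumSecondRoot_tsum]
    refine sumSecondRoot_ext fun z _ => ?_
    by_cases hz : ∃ i, z ∈ f i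
    · obtain ⟨i, hi⟩ := hz
      rw [tsum_eq_single i]
      · have : z ∈ ⋃ i, f i := Set.mem_iUnion.2 ⟨i, hi⟩
        by_cases h2 : rootDist z = n
        · rw [Set.indicator_of_mem (Set.mem_inter this h2), Set.indicator_of_mem (Set.mem_inter hi h2)]
        · rw [Set.indicator_of_notMem (fun h => h2 h.2),
            Set.indicator_of_notMem (fun h => h2 h.2)]
      · intro j hj
        exact Set.indicator_of_notMem
          (fun h => Set.disjoint_left.1 (hd hj) h.1 hi) _
    · push Not at hz
      have : z ∉ ⋃ i, f i := fun h => by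
        obtain ⟨i, hi⟩ := Set.mem_iUnion.1 h
        exact hz i hi
      simp [Set.indicator, this, hz]

/-- The counting measure of the second roots. -/
def secondRootMeasure (x : GStar Ξ) : Measure (GStarStar Ξ) :=
  Measure.sum fun v : (Quotient.out x).net.Vert =>
    Measure.dirac ((Quotient.out x).net.cls₂ ((Quotient.out x).root 0) v)

/-- The sum depends only on the isomorphism class, so the representative chosen by `Quotient.out` is
immaterial. -/
theorem lintegral_secondRootMeasure (x : GStar Ξ) {f : GStarStar Ξ → ℝ≥0∞} (hf : Measurable f) :
    ∫⁻ z, f z ∂(secondRootMeasure x) = sumSecondRoot f x := by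
  rw [secondRootMeasure, lintegral_sum_measure]
  conv_rhs => rw [← Quotient.out_eq x]
  exact tsum_congr fun v => lintegral_dirac' _ hf

theorem measurable_secondRootMeasure :
    Measurable (secondRootMeasure : GStar Ξ → Measure (GStarStar Ξ)) := by
  refine Measure.measurable_of_measurable_coe _ fun A hA => ?_
  have h := Measurable.tsum (L := .unconditional ℕ) fun n =>
    measurable_sumSecondRoot_indicator_inter n hA
  convert h using 1
  funext x
  rw [← sumSecondRoot_tsum, ← lintegral_indicator_one hA,
    lintegral_secondRootMeasure x (measurable_one.indicator hA)]
  refine sumSecondRoot_ext fun z _ => ?_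
  rw [tsum_eq_single (rootDist z)]
  · by_cases hz : z ∈ A <;> simp [Set.indicator, hz]
  · intro n hn
    exact Set.indicator_of_notMem (fun h => hn h.2.symm) _

theorem measurable_sumSecondRoot {f : GStarStar Ξ → ℝ≥0∞} (hf : Measurable f) :
    Measurable (sumSecondRoot f) := by
  have : sumSecondRoot f = fun x => ∫⁻ z, f z ∂(secondRootMeasure x) :=
    funext fun x => (lintegral_secondRootMeasure x hf).symm
  rw [this]
  exact (Measure.measurable_lintegral hf).comp measurable_secondRootMeasure

end LocalTopology

/-! ### Agreement up to all radii implies isomorphism -/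

section Separation

open Filter

variable {Ξ : Type u}

section Limit

variable {G H : Network Ξ} {S : ℕ → Set G.V} {S' : ℕ → Set H.V}

/-- `w` is the limit of the images of `v` along the hyperfilter. -/
def LimitVert (φ : ∀ n, GraphIso (G.graph.induce (S n)) (H.graph.induce (S' n)))
    (v : G.Vert) (w : H.Vert) : Prop :=
  ∀ᶠ n in (hyperfilter ℕ : Filter ℕ), ∃ h : v.1 ∈ S n, ((φ n).onV ⟨v.1, h⟩).1 = w.1

/-- `f` is the limit of the images of `e` along the hyperfilter. -/
def LimitEdge (φ : ∀ n, GraphIso (G.graph.induce (S n)) (H.graph.induce (S' n)))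
    (e : E(G.graph)) (f : E(H.graph)) : Prop :=
  ∀ᶠ n in (hyperfilter ℕ : Filter ℕ), ∃ h : e.1 ∈ E(G.graph.induce (S n)),
    ((φ n).onE ⟨e.1, h⟩).1 = f.1

variable {φ : ∀ n, GraphIso (G.graph.induce (S n)) (H.graph.induce (S' n))}

theorem LimitVert.symm {v : G.Vert} {w : H.Vert} (h : LimitVert φ v w) :
    LimitVert (fun n => (φ n).symm) w v := by
  filter_upwards [h] with n ⟨hn, e⟩
  have hw : w.1 ∈ S' n := e ▸ ((φ n).onV ⟨v.1, hn⟩).2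
  refine ⟨hw, ?_⟩
  have h1 : (⟨w.1, hw⟩ : V(H.graph.induce (S' n))) = (φ n).onV ⟨v.1, hn⟩ := Subtype.ext e.symm
  exact congrArg Subtype.val (((φ n).onV.symm_apply_eq).2 h1)

theorem LimitVert.eq {v : G.Vert} {w w' : H.Vert} (h : LimitVert φ v w) (h' : LimitVert φ v w') :
    w = w' := by
  obtain ⟨n, ⟨h1, e1⟩, ⟨h2, e2⟩⟩ := (h.and h').exists
  exact Subtype.ext (e1.symm.trans e2)

theorem LimitEdge.symm {e : E(G.graph)} {f : E(H.graph)} (h : LimitEdge φ e f) :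
    LimitEdge (fun n => (φ n).symm) f e := by
  filter_upwards [h] with n ⟨hn, e'⟩
  have hw : f.1 ∈ E(H.graph.induce (S' n)) := e' ▸ ((φ n).onE ⟨e.1, hn⟩).2
  refine ⟨hw, ?_⟩
  have h1 : (⟨f.1, hw⟩ : E(H.graph.induce (S' n))) = (φ n).onE ⟨e.1, hn⟩ := Subtype.ext e'.symm
  exact congrArg Subtype.val (((φ n).onE.symm_apply_eq).2 h1)

theorem LimitEdge.eq {v : E(G.graph)} {w w' : E(H.graph)} (h : LimitEdge φ v w)
    (h' : LimitEdge φ v w') : w = w' := by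
  obtain ⟨n, ⟨h1, e1⟩, ⟨h2, e2⟩⟩ := (h.and h').exists
  exact Subtype.ext (e1.symm.trans e2)

/-- Pigeonhole for an ultrafilter: an image confined to a finite set is eventually constant. -/
theorem exists_limitVert (hS' : ∀ n, S' n ⊆ V(H.graph)) {v : G.Vert} {F : Set H.Vert}
    (hF : F.Finite)
    (h : ∀ᶠ n in (hyperfilter ℕ : Filter ℕ), ∃ h : v.1 ∈ S n, imageVert (φ n) (hS' n) v h ∈ F) :
    ∃ w, LimitVert φ v w := by
  obtain ⟨w, -, hw⟩ := ((hyperfilter ℕ).eventually_exists_mem_iff hF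
    (P := fun w n => ∃ h : v.1 ∈ S n, ((φ n).onV ⟨v.1, h⟩).1 = w.1)).1
    (h.mono fun n ⟨hn, hm⟩ => ⟨_, hm, hn, rfl⟩)
  exact ⟨w, hw⟩

/-- Along the ultrafilter the image edge is incident to the limit of an end of `e`, so local
finiteness leaves finitely many candidates. -/
theorem exists_limitEdge (hV : ∀ v : G.Vert, ∃ w, LimitVert φ v w) (e : E(G.graph)) :
    ∃ f, LimitEdge φ e f := by
  obtain ⟨u, v, huv⟩ := Graph.exists_isLink_of_mem_edgeSet e.2
  obtain ⟨u', hu'⟩ := hV ⟨u, huv.left_mem⟩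
  obtain ⟨v', hv'⟩ := hV ⟨v, huv.right_mem⟩
  obtain ⟨f, hf, h⟩ := ((hyperfilter ℕ).eventually_exists_mem_iff (H.locallyFinite u'.1 u'.2)
    (P := fun f n => ∃ h : e.1 ∈ E(G.graph.induce (S n)), ((φ n).onE ⟨e.1, h⟩).1 = f)).1 (by
    filter_upwards [hu', hv'] with n ⟨h1, e1⟩ ⟨h2, e2⟩
    have he : e.1 ∈ E(G.graph.induce (S n)) := ⟨u, v, huv, h1, h2⟩
    have hl := ((φ n).isLink_iff ⟨e.1, he⟩ ⟨u, h1⟩ ⟨v, h2⟩).2 ⟨huv, h1, h2⟩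
    refine ⟨_, ?_, he, rfl⟩
    rw [← e1]
    exact hl.1.inc_left)
  exact ⟨⟨f, Graph.Inc.edge_mem hf⟩, h⟩

theorem limit_isLink {e : E(G.graph)} {f : E(H.graph)} {x y : G.Vert} {x' y' : H.Vert}
    (he : LimitEdge φ e f) (hx : LimitVert φ x x') (hy : LimitVert φ y y') :
    H.graph.IsLink f.1 x'.1 y'.1 ↔ G.graph.IsLink e.1 x.1 y.1 := by
  obtain ⟨n, ⟨h1, e1⟩, ⟨h2, e2⟩, ⟨h3, e3⟩⟩ := (he.and (hx.and hy)).exists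
  have := (φ n).isLink_iff ⟨e.1, h1⟩ ⟨x.1, h2⟩ ⟨y.1, h3⟩
  have hx' := ((φ n).onV ⟨x.1, h2⟩).2
  have hy' := ((φ n).onV ⟨y.1, h3⟩).2
  rw [e1, e2, e3] at this
  rw [e2] at hx'
  rw [e3] at hy'
  exact ⟨fun h => (this.1 ⟨h, hx', hy'⟩).1, fun h => (this.2 ⟨h, h2, h3⟩).1⟩

/-- A sequence of isomorphisms of induced subgraphs that has limits at all vertices in both
directions yields an isomorphism. -/
theorem exists_graphIso_of_limits (hV : ∀ v : G.Vert, ∃ w, LimitVert φ v w)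
    (hV' : ∀ w : H.Vert, ∃ v, LimitVert (fun n => (φ n).symm) w v) :
    ∃ ψ : GraphIso G.graph H.graph, (∀ v, LimitVert φ v (ψ.onV v)) ∧
      ∀ e, LimitEdge φ e (ψ.onE e) := by
  have hE := exists_limitEdge hV
  have hE' := exists_limitEdge hV'
  choose f hf using hV
  choose g hg using hV'
  choose f' hf' using hE
  choose g' hg' using hE'
  exact ⟨{
    onV := ⟨f, g, fun v => (hg (f v)).eq (hf v).symm, fun w => (hf (g w)).eq (hg w).symm⟩
    onE := ⟨f', g', fun v => (hg' (f' v)).eq (hf' v).symm, fun w => (hf' (g' w)).eq (hg' w).symm⟩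
    isLink_iff := fun e x y => limit_isLink (hf' e) (hf x) (hf y) }, hf, hf'⟩

end Limit

variable [MetricSpace Ξ]

theorem eq_of_eventually_dist_lt {a b : Ξ}
    (h : ∀ᶠ n : ℕ in (hyperfilter ℕ : Filter ℕ), dist a b < 1 / ((n : ℝ) + 1)) : a = b := by
  refine dist_le_zero.1 (ge_of_tendsto (x := (hyperfilter ℕ : Filter ℕ))
    (tendsto_one_div_add_atTop_nhds_zero_nat.mono_left ?_) (h.mono fun n hn => hn.le))
  rw [← Nat.cofinite_eq_atTop]
  exact hyperfilter_le_cofinite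

/-- Compactness: isomorphisms of growing balls converge along an ultrafilter, because the image of a
vertex stays in a fixed finite ball. Corresponding marks differ by less than `1 / (n + 1)` for
ultrafilter-many `n`, hence are equal. -/
theorem eq_of_forall_near {a b : GStar Ξ} (h : ∀ n : ℕ, Near ((n : ℝ) + 1) a b) : a = b := by
  obtain ⟨G, o, rfl⟩ := GStar.exists_rep a
  obtain ⟨H, o', rfl⟩ := GStar.exists_rep b
  have h' n := (agree_iff_agreeWith.1 (h n).agree).2
  choose φ hroot hφ using h'
  have hpos (n : ℕ) : (0 : ℝ) ≤ n + 1 := by positivity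
  have hS (n : ℕ) := (⟨G, ![o]⟩ : RootedNetwork Ξ 1).nbhd_subset ((n : ℝ) + 1)
  have hS' (n : ℕ) := (⟨H, ![o']⟩ : RootedNetwork Ξ 1).nbhd_subset ((n : ℝ) + 1)
  -- Stated for arbitrary networks so that it applies to the inverse isomorphisms as well.
  have key (G H : Network Ξ) (o : G.Vert) (o' : H.Vert)
      (φ : ∀ n : ℕ, GraphIso
        (G.graph.induce ((⟨G, ![o]⟩ : RootedNetwork Ξ 1).nbhd ((n : ℝ) + 1)))
        (H.graph.induce ((⟨H, ![o']⟩ : RootedNetwork Ξ 1).nbhd ((n : ℝ) + 1))))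
      (hS' : ∀ n : ℕ, (⟨H, ![o']⟩ : RootedNetwork Ξ 1).nbhd ((n : ℝ) + 1) ⊆ V(H.graph))
      (ho : ∀ n h, imageVert (φ n) (hS' n) o h = o') (v : G.Vert) : ∃ w, LimitVert φ v w := by
    have hmem (n : ℕ) (hn : G.dist o v ≤ n) (w : G.Vert) (hw : G.dist o w ≤ G.dist o v) :
        w.1 ∈ (⟨G, ![o]⟩ : RootedNetwork Ξ 1).nbhd ((n : ℝ) + 1) := by
      refine (mem_nbhd_iff (⟨G, ![o]⟩ : RootedNetwork Ξ 1) _ w).2 ⟨0, ?_⟩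
      have : (G.dist o w : ℝ) ≤ n := by exact_mod_cast hw.trans hn
      show (G.dist o w : ℝ) ≤ n + 1
      linarith
    refine exists_limitVert hS' (H.finite_dist_le o' (G.dist o v)) ?_
    have hle : (hyperfilter ℕ : Filter ℕ) ≤ atTop := by
      rw [← Nat.cofinite_eq_atTop]
      exact hyperfilter_le_cofinite
    filter_upwards [hle (eventually_ge_atTop (G.dist o v))] with n hn
    refine ⟨hmem n hn v le_rfl, ?_⟩
    have := dist_imageVert_le (φ n) (hS' n) o (hmem n hn o (by rw [G.dist_self]; exact Nat.zero_le _))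
      (G.dist o v) (hmem n hn) _ le_rfl v le_rfl
    rwa [ho] at this
  have ho n h : imageVert (φ n) (hS' n) o h = o' := Subtype.ext (hroot n 0 ⟨o.1, h⟩ rfl)
  obtain ⟨ψ, hψV, hψE⟩ := exists_graphIso_of_limits (key G H o o' φ hS' ho)
    (key H G o' o (fun n => (φ n).symm) hS fun n h => imageVert_symm (φ n) (hS n) (hS' n)
      (root_mem_nbhd _ (hpos n) 0) (ho n _) h)
  refine Quotient.sound ⟨⟨ψ, fun v => ?_, fun v e hi hi' => ?_⟩, fun i => ?_⟩
  · refine eq_of_eventually_dist_lt ?_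
    filter_upwards [hψV v] with n ⟨hn, e⟩
    have h1 := (hφ n).1 ⟨v.1, hn⟩
    have h2 : (⟨((φ n).onV ⟨v.1, hn⟩).1, hS' n ((φ n).onV ⟨v.1, hn⟩).2⟩ : H.Vert) = ψ.onV v :=
      Subtype.ext e
    rw [← h2]
    exact h1
  · refine eq_of_eventually_dist_lt ?_
    filter_upwards [hψV v, hψE e] with n ⟨hn, e1⟩ ⟨hn', e2⟩
    obtain ⟨y, hy⟩ := id hi
    obtain ⟨p, q, hpq, hp, hq⟩ := id hn'
    -- Incidence in the ball requires both ends of `e` to lie in it, which holds because `e` is an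
    -- edge of the ball.
    have hinc : (G.graph.induce ((⟨G, ![o]⟩ : RootedNetwork Ξ 1).nbhd ((n : ℝ) + 1))).Inc
        e.1 v.1 := by
      rcases hi.eq_or_eq_of_isLink hpq with h | h
      · exact ⟨q, h ▸ hpq, hn, hq⟩
      · exact ⟨p, h ▸ hpq.symm, hn, hp⟩
    have hinc' := (φ n).inc ⟨e.1, hn'⟩ ⟨v.1, hn⟩ hinc
    have h1 := (hφ n).2 ⟨v.1, hn⟩ ⟨e.1, hn'⟩ hinc hinc'
    have h2 := H.edgeMark_congr e1 e2 (hinc'.imp fun _ h => h.1) hi'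
    rw [← h2]
    exact h1
  · fin_cases i
    refine LimitVert.eq (hψV o) (Eventually.of_forall fun n => ?_)
    exact ⟨root_mem_nbhd (⟨G, ![o]⟩ : RootedNetwork Ξ 1) (hpos n) 0, hroot n 0 _ rfl⟩

end Separation

/-! ### Measurability of the relation of having the same unrooted network -/

section Code

variable {Ξ : Type u}

/-- Combinatorial data that describe a finite rooted multigraph whose marks are numbers. -/
abbrev BallCode : Type :=
  Σ N : ℕ, Σ M : ℕ, Fin N × (Fin M → Fin N → Fin N → Prop) × (Fin N → ℕ) × (Fin N → Fin M → ℕ)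

theorem RootedNetwork.finite_ball_vertexSet (x : RootedNetwork Ξ 1) (r : ℝ) :
    Finite V((x.ball r).graph) := by
  refine Set.Finite.to_subtype ?_
  refine ((x.net.finite_dist_le (x.root 0) ⌊r⌋₊).image Subtype.val).subset ?_
  rintro v ⟨hv, i, hi⟩
  refine ⟨⟨v, hv⟩, ?_, rfl⟩
  rw [Subsingleton.elim i 0] at hi
  exact Nat.le_floor hi

theorem RootedNetwork.finite_ball_edgeSet (x : RootedNetwork Ξ 1) (r : ℝ) :
    Finite E((x.ball r).graph) := by
  refine Set.Finite.to_subtype ?_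
  have hfin : (x.nbhd r).Finite :=
    Set.finite_coe_iff.1 (x.finite_ball_vertexSet r)
  refine (hfin.biUnion (t := fun v => {e | x.net.graph.Inc e v})
    fun v hv => x.net.locallyFinite v hv.1).subset ?_
  rintro e ⟨u, v, he, hu, hv⟩
  exact Set.mem_biUnion hu he.inc_left

theorem forget_eq_iff {x y : GStar Ξ} :
    forget x = forget y ↔ ∃ z, proj₁ z = x ∧ proj₂ z = y := by
  constructor
  · intro h
    obtain ⟨G, o, rfl⟩ := GStar.exists_rep x
    obtain ⟨H, p, rfl⟩ := GStar.exists_rep y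
    rw [forget_cls₁, forget_cls₁] at h
    obtain ⟨φ⟩ := Quotient.exact h
    refine ⟨G.cls₂ o (φ.onV.symm p), proj₁_cls₂ _ _ _, (proj₂_cls₂ _ _ _).trans ?_⟩
    refine Quotient.sound ⟨φ, fun i => ?_⟩
    fin_cases i
    exact φ.onV.apply_symm_apply p
  · rintro ⟨z, rfl, rfl⟩
    obtain ⟨G, o, v, rfl⟩ := GStarStar.exists_rep z
    rw [proj₁_cls₂, proj₂_cls₂]
    rfl

theorem exists_cls₂_of_proj₁_eq {z : GStarStar Ξ} {G : Network Ξ} {o : G.Vert}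
    (hz : proj₁ z = G.cls₁ o) : ∃ v, G.cls₂ o v = z := by
  obtain ⟨H, p, w, rfl⟩ := GStarStar.exists_rep z
  rw [proj₁_cls₂] at hz
  obtain ⟨φ, hφ⟩ := Quotient.exact hz.symm
  refine ⟨φ.onV.symm w, Quotient.sound ⟨φ, fun i => ?_⟩⟩
  fin_cases i
  · exact hφ 0
  · exact φ.onV.apply_symm_apply w

variable [MetricSpace Ξ]

/-- `c` describes the ball of radius `r` in `x` if the number `i` stands for a mark at distance less
than `δ` from `d i`. -/
def HasCode (d : ℕ → Ξ) (δ r : ℝ) (x : RootedNetwork Ξ 1) (c : BallCode) : Prop :=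
  ∃ (f : V((x.ball r).graph) ≃ Fin c.1) (g : E((x.ball r).graph) ≃ Fin c.2.1),
    (∀ v, v.1 = (x.root 0).1 → f v = c.2.2.1) ∧
    (∀ e u v, c.2.2.2.1 (g e) (f u) (f v) ↔ (x.ball r).graph.IsLink e.1 u.1 v.1) ∧
    (∀ v, dist ((x.ball r).vertexMark v) (d (c.2.2.2.2.1 (f v))) < δ) ∧
    ∀ v e (h : (x.ball r).graph.Inc e.1 v.1),
      dist ((x.ball r).edgeMark v.1 e.1 h) (d (c.2.2.2.2.2 (f v) (g e))) < δ

theorem exists_hasCode {d : ℕ → Ξ} (hd : DenseRange d) {δ r : ℝ} (hδ : 0 < δ) (hr : 0 ≤ r)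
    (x : RootedNetwork Ξ 1) : ∃ c, HasCode d δ r x c := by
  classical
  have := x.finite_ball_vertexSet r
  have := x.finite_ball_edgeSet r
  have hdense (m : Ξ) : ∃ i, dist m (d i) < δ := hd.exists_dist_lt m hδ
  choose j hj using hdense
  obtain ⟨N, ⟨f⟩⟩ := Finite.exists_equiv_fin V((x.ball r).graph)
  obtain ⟨M, ⟨g⟩⟩ := Finite.exists_equiv_fin E((x.ball r).graph)
  have hf v : (f.symm (f v)).1 = v.1 := by rw [f.symm_apply_apply]
  have hg e : (g.symm (g e)).1 = e.1 := by rw [g.symm_apply_apply]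
  refine ⟨⟨N, M, f ⟨(x.root 0).1, root_mem_nbhd x hr 0⟩,
    fun e u v => (x.ball r).graph.IsLink (g.symm e).1 (f.symm u).1 (f.symm v).1,
    fun v => j ((x.ball r).vertexMark (f.symm v)),
    -- The value `0` at non-incident pairs is arbitrary: a code is tested only at incident pairs.
    fun v e => if h : (x.ball r).graph.Inc (g.symm e).1 (f.symm v).1 then
      j ((x.ball r).edgeMark (f.symm v).1 (g.symm e).1 h) else 0⟩, f, g, ?_, ?_, ?_, ?_⟩
  · exact fun v hv => congrArg f (Subtype.ext hv)
  · intro e u v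
    simp only [hf, hg]
  · intro v
    show dist _ (d (j ((x.ball r).vertexMark (f.symm (f v))))) < δ
    rw [f.symm_apply_apply]
    exact hj _
  · intro v e h
    have h' : (x.ball r).graph.Inc (g.symm (g e)).1 (f.symm (f v)).1 := by
      rwa [hf, hg]
    simp only [dif_pos h']
    rw [(x.ball r).edgeMark_congr (hf v).symm (hg e).symm h h']
    exact hj _

/-- The two numberings compose to an isomorphism of the balls, and corresponding marks are within
`δ` of the same point of the sequence. -/
theorem HasCode.agreeWith {d : ℕ → Ξ} {δ r : ℝ} {x y : RootedNetwork Ξ 1} {c : BallCode}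
    (hr : 0 ≤ r) (hx : HasCode d δ r x c) (hy : HasCode d δ r y c) :
    AgreeWith (fun a b => dist a b < δ + δ) r x y := by
  obtain ⟨f, g, h1, h2, h3, h4⟩ := hx
  obtain ⟨f', g', h1', h2', h3', h4'⟩ := hy
  refine ⟨fun i j => ?_, ⟨f.trans f'.symm, g.trans g'.symm, fun e u v => ?_⟩, fun i v hv => ?_,
    fun v => ?_, fun v e h h' => ?_⟩
  · rw [Subsingleton.elim i 0, Subsingleton.elim j 0, x.net.dist_self, y.net.dist_self]
  · rw [← h2, ← h2']
    simp
  · rw [Subsingleton.elim i 0] at hv ⊢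
    have e := (h1 v hv).trans (h1' ⟨(y.root 0).1, root_mem_nbhd y hr 0⟩ rfl).symm
    exact congrArg Subtype.val ((f'.symm_apply_eq).2 e)
  · have := h3' (f'.symm (f v))
    rw [Equiv.apply_symm_apply] at this
    exact (dist_triangle_right _ _ _).trans_lt (add_lt_add (h3 v) this)
  · have := h4' (f'.symm (f v)) (g'.symm (g e)) h'
    rw [Equiv.apply_symm_apply, Equiv.apply_symm_apply] at this
    exact (dist_triangle_right _ _ _).trans_lt (add_lt_add (h4 v e h) this)

/-- A countable family of open sets that separates the points of `𝒢_*` from the finite sets. -/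
theorem exists_separating_family [TopologicalSpace.SeparableSpace Ξ] :
    ∃ U : ℕ × BallCode → Set (GStar Ξ), (∀ i, IsOpen (U i)) ∧
      ∀ (a : GStar Ξ) (F : Set (GStar Ξ)), F.Finite → a ∉ F → ∃ i, a ∈ U i ∧ ∀ b ∈ F, b ∉ U i := by
  rcases isEmpty_or_nonempty Ξ with hΞ | hΞ
  -- Without marks there are no rooted networks, as the root would need a mark.
  · refine ⟨fun _ => ∅, fun _ => isOpen_empty, fun a => ?_⟩
    obtain ⟨G, o, rfl⟩ := GStar.exists_rep a
    exact (hΞ.false (G.vertexMark o)).elim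
  have hd := TopologicalSpace.denseRange_denseSeq Ξ
  set d := TopologicalSpace.denseSeq Ξ
  have hδ (n : ℕ) : (0 : ℝ) < 1 / (2 * (n + 1)) := by positivity
  have hn (n : ℕ) : (0 : ℝ) < n + 1 := by positivity
  -- Each set is the union of open balls around all networks with one code. These centres agree
  -- pairwise up to radius `n + 1`, so the set is small, and the index set is countable. The
  -- tolerance is half of `1 / (n + 1)` because two marks are compared through a third point.
  refine ⟨fun i => ⋃ x ∈ {x | HasCode d (1 / (2 * (i.1 + 1))) (i.1 + 1) x i.2},
    {b | x.cls.distance b < (1 + ENNReal.ofReal (i.1 + 1))⁻¹}, fun i => ?_, fun a F hF haF => ?_⟩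
  · exact isOpen_biUnion fun x _ => TopologicalSpace.isOpen_generateFrom_of_mem ⟨x.cls, _, rfl⟩
  · have hsep (b : GStar Ξ) (hb : b ∈ F) : ∃ m : ℕ, ¬ Near ((m : ℝ) + 1) a b := by
      by_contra! h
      exact haF (eq_of_forall_near h ▸ hb)
    choose! m hm using hsep
    obtain ⟨K, hK⟩ := (hF.image m).bddAbove
    obtain ⟨x, rfl⟩ := RootedClass.exists_rep a
    -- Chaining two agreements up to radius `n + 1` leaves radius `(n + 1) / 2`, which has to be at
    -- least `K + 1`.
    set n := 2 * (K + 1) with hndef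
    obtain ⟨c, hc⟩ := exists_hasCode hd (hδ n) (hn n).le x
    refine ⟨(n, c), Set.mem_biUnion hc ?_, fun b hb hbU => ?_⟩
    · have h2 : (0 : ℝ) < n + 2 := by positivity
      refine lt_of_le_of_lt (distance_le_of_near h2 (Near.refl h2 _)) (ENNReal.inv_lt_inv.2 ?_)
      refine ENNReal.add_lt_add_left ENNReal.one_ne_top ?_
      exact (ENNReal.ofReal_lt_ofReal_iff h2).2 (by linarith)
    · simp only [Set.mem_iUnion] at hbU
      obtain ⟨y, hy, hyb⟩ := hbU
      have h1 : Near ((n : ℝ) + 1) y.cls b := near_of_distance_lt (hn n) hyb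
      have h2 : Near ((n : ℝ) + 1) x.cls y.cls := by
        refine .of_agree ((HasCode.agreeWith (hn n).le hc hy).mono (hn n).le le_rfl
          fun a b hab => hab.trans_le (le_of_eq ?_))
        field_simp
        norm_num
      have h3 : Near (((n : ℝ) + 1) / 2) x.cls b := by
        refine Near.trans (by positivity) (by linarith [hn n]) (by linarith [hn n])
          (le_of_eq ?_) h2 h1
        field_simp
        norm_num
      refine hm b hb (h3.mono (by positivity) ?_)
      have h4 : m b ≤ K := hK ⟨b, hb, rfl⟩
      have h5 : (m b : ℝ) ≤ K := by exact_mod_cast h4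
      rw [hndef]
      push_cast
      linarith

/-- For each `n`, the rootings of the first network at distance `n` are finitely many, so if the
second class is none of them, some set of the countable family contains it and misses them all. That
a set is missed is the vanishing of a measurable count. -/
theorem measurableSet_forget_eq [TopologicalSpace.SeparableSpace Ξ] :
    MeasurableSet {p : GStar Ξ × GStar Ξ | forget p.1 = forget p.2} := by
  obtain ⟨U, hU, hsep⟩ := exists_separating_family (Ξ := Ξ)
  have heq : {p : GStar Ξ × GStar Ξ | forget p.1 = forget p.2}ᶜ = ⋂ n : ℕ, ⋃ i : ℕ × BallCode,
      {p | p.2 ∈ U i ∧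
        sumSecondRoot ((proj₂ ⁻¹' (U i) ∩ rootDist ⁻¹' {n}).indicator 1) p.1 = 0} := by
    ext ⟨x, y⟩
    simp only [Set.mem_compl_iff, Set.mem_ofPred_eq, Set.mem_iInter, Set.mem_iUnion,
      sumSecondRoot_eq_zero_iff, forget_eq_iff]
    constructor
    · intro h n
      obtain ⟨G, o, rfl⟩ := GStar.exists_rep x
      obtain ⟨i, hi, hF⟩ := hsep y ((fun v => G.cls₁ v) '' {v | G.dist o v ≤ n})
        ((G.finite_dist_le o n).image _) (by
          rintro ⟨v, -, rfl⟩
          exact h ⟨G.cls₂ o v, proj₁_cls₂ _ _ _, proj₂_cls₂ _ _ _⟩)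
      refine ⟨i, hi, fun z hz => Set.indicator_of_notMem ?_ _⟩
      rintro ⟨h1, h2⟩
      obtain ⟨v, rfl⟩ := exists_cls₂_of_proj₁_eq hz
      rw [Set.mem_preimage, proj₂_cls₂] at h1
      exact hF _ ⟨v, le_of_eq h2, rfl⟩ h1
    · rintro h ⟨z, rfl, rfl⟩
      obtain ⟨i, hi, h0⟩ := h (rootDist z)
      have hz : z ∈ proj₂ ⁻¹' U i ∩ rootDist ⁻¹' {rootDist z} := ⟨hi, rfl⟩
      have := h0 z rfl
      rw [Set.indicator_of_mem hz] at this
      exact one_ne_zero this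
  rw [← MeasurableSet.compl_iff, heq]
  refine .iInter fun n => .iUnion fun i => ?_
  refine .inter (measurable_snd (hU i).measurableSet) ?_
  have h1 : MeasurableSet (proj₂ ⁻¹' (U i) ∩ rootDist ⁻¹' {n}) :=
    (measurable_proj₂ (hU i).measurableSet).inter (measurable_rootDist (measurableSet_singleton n))
  exact ((measurable_sumSecondRoot (measurable_one.indicator h1)).comp measurable_fst)
    (measurableSet_singleton 0)

end Code

/-! ### The kernel with positive weights and the implications -/

section Equivalence

variable {Ξ : Type u}

theorem le_sumSecondRoot (f : GStarStar Ξ → ℝ≥0∞) (z : GStarStar Ξ) :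
    f z ≤ sumSecondRoot f (proj₁ z) := by
  obtain ⟨G, o, v, rfl⟩ := GStarStar.exists_rep z
  rw [proj₁_cls₂, sumSecondRoot_cls₁]
  exact ENNReal.le_tsum v

/-- The number of vertices at distance `n` from the root. -/
def sphereCard (n : ℕ) : GStar Ξ → ℝ≥0∞ := sumSecondRoot ((rootDist ⁻¹' {n}).indicator 1)

/-- The transition weights of a random new root: a positive function with sum at most one over the
second roots. -/
def walkWeight (z : GStarStar Ξ) : ℝ≥0∞ :=
  ∑' n : ℕ, 2⁻¹ ^ (n + 1) * (1 + sphereCard n (proj₁ z))⁻¹ *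
    (rootDist ⁻¹' {n} : Set (GStarStar Ξ)).indicator 1 z

/-- A sphere with `N` vertices contributes `2⁻¹ ^ (n + 1) * N / (1 + N)`; the added `1` avoids
inverting zero at empty spheres. -/
theorem sumSecondRoot_walkWeight_le (x : GStar Ξ) : sumSecondRoot walkWeight x ≤ 1 := by
  have hle (n : ℕ) : sumSecondRoot (fun z : GStarStar Ξ =>
      2⁻¹ ^ (n + 1) * (1 + sphereCard n (proj₁ z))⁻¹ *
        (rootDist ⁻¹' {n} : Set (GStarStar Ξ)).indicator 1 z) x ≤ 2⁻¹ ^ (n + 1) := by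
    rw [sumSecondRoot_proj₁_mul (fun y => 2⁻¹ ^ (n + 1) * (1 + sphereCard n y)⁻¹), mul_assoc]
    refine (mul_le_mul_right ?_ _).trans (mul_one _).le
    rw [mul_comm, ← div_eq_mul_inv]
    exact ENNReal.div_le_of_le_mul (by rw [one_mul]; exact le_add_self)
  refine (sumSecondRoot_tsum _ x).le.trans ((ENNReal.tsum_le_tsum hle).trans (le_of_eq ?_))
  rw [ENNReal.tsum_geometric_add_one, ENNReal.one_sub_inv_two, inv_inv]
  exact ENNReal.inv_mul_cancel (by simp) (by simp)

theorem walkWeight_ne_zero (z : GStarStar Ξ) : walkWeight z ≠ 0 := by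
  intro h
  have h1 := ENNReal.tsum_eq_zero.1 h (rootDist z)
  have hz : z ∈ (rootDist ⁻¹' {rootDist z} : Set (GStarStar Ξ)) := rfl
  rw [Set.indicator_of_mem hz, Pi.one_apply, mul_one, mul_eq_zero] at h1
  rcases h1 with h1 | h1
  · exact pow_ne_zero _ (by simp) h1
  · rw [ENNReal.inv_eq_zero, ENNReal.add_eq_top] at h1
    refine h1.elim ENNReal.one_ne_top
      (sumSecondRoot_indicator_lt_top (rootDist z) (fun w hw => le_of_eq hw) (proj₁ z)).ne

theorem walkWeight_ne_top (z : GStarStar Ξ) : walkWeight z ≠ ∞ :=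
  ne_top_of_le_ne_top ENNReal.one_ne_top
    ((le_sumSecondRoot _ z).trans (sumSecondRoot_walkWeight_le _))

variable [MetricSpace Ξ]

theorem lintegral_bind_secondRootMeasure (μ : Measure (GStar Ξ)) {f : GStarStar Ξ → ℝ≥0∞}
    (hf : Measurable f) :
    ∫⁻ z, f z ∂(μ.bind secondRootMeasure) = ∫⁻ x, sumSecondRoot f x ∂μ := by
  rw [Measure.lintegral_bind measurable_secondRootMeasure.aemeasurable hf.aemeasurable]
  exact lintegral_congr fun x => lintegral_secondRootMeasure x hf

theorem measurable_indicator_rootDist (n : ℕ) :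
    Measurable ((rootDist ⁻¹' {n} : Set (GStarStar Ξ)).indicator (1 : GStarStar Ξ → ℝ≥0∞)) :=
  measurable_one.indicator (measurable_rootDist (measurableSet_singleton n))

theorem measurable_walkWeight : Measurable (walkWeight : GStarStar Ξ → ℝ≥0∞) := by
  have hn (n : ℕ) : Measurable fun z : GStarStar Ξ =>
      2⁻¹ ^ (n + 1) * (1 + sphereCard n (proj₁ z))⁻¹ *
        (rootDist ⁻¹' {n} : Set (GStarStar Ξ)).indicator 1 z := by
    have h1 : Measurable (sphereCard n : GStar Ξ → ℝ≥0∞) :=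
      measurable_sumSecondRoot (measurable_indicator_rootDist n)
    exact (((h1.comp measurable_proj₁).const_add 1).inv.const_mul _).mul
      (measurable_indicator_rootDist n)
  exact Measurable.tsum (L := .unconditional ℕ) hn

/-- The sub-probability kernel from `𝒢_*` to `𝒢_**` with weights `walkWeight`. -/
def walkKernel (x : GStar Ξ) : Measure (GStarStar Ξ) := (secondRootMeasure x).withDensity walkWeight

theorem lintegral_walkKernel (x : GStar Ξ) {f : GStarStar Ξ → ℝ≥0∞} (hf : Measurable f) :
    ∫⁻ z, f z ∂(walkKernel x) = sumSecondRoot (fun z => walkWeight z * f z) x := by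
  rw [walkKernel, lintegral_withDensity_eq_lintegral_mul _ measurable_walkWeight hf,
    lintegral_secondRootMeasure x (measurable_walkWeight.mul hf)]
  rfl

theorem walkKernel_apply (x : GStar Ξ) {A : Set (GStarStar Ξ)} (hA : MeasurableSet A) :
    walkKernel x A = sumSecondRoot (fun z => walkWeight z * A.indicator 1 z) x := by
  rw [← lintegral_indicator_one hA, lintegral_walkKernel x (measurable_one.indicator hA)]

theorem measurable_walkKernel : Measurable (walkKernel : GStar Ξ → Measure (GStarStar Ξ)) := by
  refine Measure.measurable_of_measurable_coe _ fun A hA => ?_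
  simp only [walkKernel_apply _ hA]
  exact measurable_sumSecondRoot (measurable_walkWeight.mul (measurable_one.indicator hA))

theorem walkKernel_preimage_proj₁_le (x : GStar Ξ) (B : Set (GStar Ξ)) (hB : MeasurableSet B) :
    walkKernel x (proj₁ ⁻¹' B) ≤ B.indicator 1 x := by
  have h : (fun z : GStarStar Ξ => walkWeight z * (proj₁ ⁻¹' B).indicator 1 z) =
      fun z => B.indicator 1 (proj₁ z) * walkWeight z :=
    funext fun z => mul_comm _ _
  rw [walkKernel_apply x (measurable_proj₁ hB), h, sumSecondRoot_proj₁_mul]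
  exact (mul_le_mul_right (sumSecondRoot_walkWeight_le x) _).trans (mul_one _).le

/-- As the weights are positive everywhere, the points from which the kernel reaches `A` form
exactly the saturation of `A`, which is the saturation hypothesis of the matching argument. -/
theorem walkKernel_preimage_proj₂_ne_zero_iff (x : GStar Ξ) (A : Set (GStar Ξ))
    (hA : MeasurableSet A) :
    walkKernel x (proj₂ ⁻¹' A) ≠ 0 ↔ ∃ y ∈ A, forget x = forget y := by
  rw [walkKernel_apply x (measurable_proj₂ hA), Ne, sumSecondRoot_eq_zero_iff]
  push Not
  constructor
  · rintro ⟨z, hz, h⟩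
    have hzA : z ∈ proj₂ ⁻¹' A := Set.mem_of_indicator_ne_zero (right_ne_zero_of_mul h)
    exact ⟨proj₂ z, hzA,
      forget_eq_iff.2 ⟨z, hz, rfl⟩⟩
  · rintro ⟨y, hy, h⟩
    obtain ⟨z, hz, rfl⟩ := forget_eq_iff.1 h
    have hzA : z ∈ proj₂ ⁻¹' A := hy
    refine ⟨z, hz, ?_⟩
    rw [Set.indicator_of_mem hzA, Pi.one_apply, mul_one]
    exact walkWeight_ne_zero z

variable {μ₁ μ₂ : Measure (GStar Ξ)}

/-- An invariant set is the full preimage of its image under `forget`, and `J` is defined so that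
this image is measurable. -/
theorem ConditionF.conditionF' (h : ConditionF μ₁ μ₂) : ConditionF' μ₁ μ₂ := by
  rintro A ⟨hA, hinv⟩
  have hpre : forget ⁻¹' (forget '' A) = A := by
    refine Set.Subset.antisymm ?_ (Set.subset_preimage_image _ _)
    rintro x ⟨y, hy, hxy⟩
    obtain ⟨z, rfl, rfl⟩ := forget_eq_iff.1 hxy
    obtain ⟨G, o, v, rfl⟩ := GStarStar.exists_rep z
    rw [proj₁_cls₂] at hy
    rw [proj₂_cls₂]
    exact hinv G o v hy
  have hm : MeasurableSet (forget '' A) := by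
    show MeasurableSet (forget ⁻¹' (forget '' A))
    rwa [hpre]
  have := congrArg (fun μ => μ (forget '' A)) h
  simpa only [Measure.map_apply measurable_forget hm, hpre] using this

theorem ConditionF'.conditionF (h : ConditionF' μ₁ μ₂) : ConditionF μ₁ μ₂ := by
  refine Measure.ext fun B hB => ?_
  rw [Measure.map_apply measurable_forget hB, Measure.map_apply measurable_forget hB]
  exact h _ ⟨measurable_forget hB, fun G o v ho => ho⟩

theorem ConditionC.conditionF (h : ConditionC μ₁ μ₂) : ConditionF μ₁ μ₂ := by
  obtain ⟨ρ, -, rfl, rfl, hρ⟩ := h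
  refine Measure.ext fun B hB => ?_
  have hB' := measurable_forget hB
  rw [Measure.map_apply measurable_forget hB, Measure.map_apply measurable_forget hB,
    Measure.map_apply measurable_fst hB', Measure.map_apply measurable_snd hB']
  refine measure_congr ?_
  filter_upwards [hρ] with p hp
  exact propext (by
    show forget p.1 ∈ B ↔ forget p.2 ∈ B
    rw [hp])

theorem ConditionD.conditionC [TopologicalSpace.SeparableSpace Ξ] (h : ConditionD μ₁ μ₂) :
    ConditionC μ₁ μ₂ := by
  obtain ⟨ρ, hρ, rfl, rfl⟩ := h
  have hm : Measurable fun z : GStarStar Ξ => (proj₁ z, proj₂ z) :=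
    measurable_proj₁.prodMk measurable_proj₂
  refine ⟨ρ.map fun z => (proj₁ z, proj₂ z), Measure.isProbabilityMeasure_map hm.aemeasurable,
    Measure.map_map measurable_fst hm, Measure.map_map measurable_snd hm, ?_⟩
  -- The relation holds at every image point, but the transfer to the image measure uses that it is
  -- measurable.
  rw [ae_map_iff hm.aemeasurable measurableSet_forget_eq]
  exact Filter.Eventually.of_forall fun z => forget_eq_iff.2 ⟨z, rfl, rfl⟩

/-- The measure on $\mathcal G_{**}$ has density `T` with respect to `μ₁` followed by counting of
second roots. -/
theorem ConditionR.conditionD [IsProbabilityMeasure μ₁] (h : ConditionR μ₁ μ₂) :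
    ConditionD μ₁ μ₂ := by
  obtain ⟨T, hT, hsum, hν⟩ := h
  have hT' : Measurable fun z => (T z : ℝ≥0∞) := hT.coe_nnreal_ennreal
  set ρ := (μ₁.bind secondRootMeasure).withDensity fun z => (T z : ℝ≥0∞) with hρ
  have happ (A : Set (GStarStar Ξ)) (hA : MeasurableSet A) :
      ρ A = ∫⁻ x, sumSecondRoot (fun z => (T z : ℝ≥0∞) * A.indicator 1 z) x ∂μ₁ := by
    rw [← lintegral_indicator_one hA, hρ,
      lintegral_withDensity_eq_lintegral_mul _ hT' (measurable_one.indicator hA)]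
    exact lintegral_bind_secondRootMeasure _ (hT'.mul (measurable_one.indicator hA))
  have h1 : ρ.map proj₁ = μ₁ := by
    refine Measure.ext fun A hA => ?_
    rw [Measure.map_apply measurable_proj₁ hA, happ _ (measurable_proj₁ hA),
      ← lintegral_indicator_one hA]
    refine lintegral_congr_ae ?_
    filter_upwards [hsum] with x hx
    have h : (fun z : GStarStar Ξ => (T z : ℝ≥0∞) * (proj₁ ⁻¹' A).indicator 1 z) =
        fun z => A.indicator 1 (proj₁ z) * (T z : ℝ≥0∞) := funext fun z => mul_comm _ _
    rw [h, sumSecondRoot_proj₁_mul, hx, mul_one]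
  have h2 : ρ.map proj₂ = μ₂ := by
    refine Measure.ext fun A hA => ?_
    rw [Measure.map_apply measurable_proj₂ hA, happ _ (measurable_proj₂ hA), hν A hA]
    rfl
  refine ⟨ρ, ⟨?_⟩, h1, h2⟩
  rw [← Set.preimage_univ (f := proj₁), ← Measure.map_apply measurable_proj₁ .univ, h1,
    measure_univ]

theorem ConditionF'.exists_transport [IsProbabilityMeasure μ₁] [IsProbabilityMeasure μ₂]
    (h : ConditionF' μ₁ μ₂) : ∃ ρ : Measure (GStarStar Ξ), ρ ≪ μ₁.bind walkKernel ∧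
      ρ.map proj₁ = μ₁ ∧ ρ.map proj₂ = μ₂ := by
  refine UnrootedEquivalence.exists_transport μ₁ μ₂ measurable_walkKernel measurable_proj₁
    measurable_proj₂ walkKernel_preimage_proj₁_le (fun A hA => ⟨fun x hx => ?_, fun z => ?_⟩)
    fun A hA hinv => h A ⟨hA, fun G o v ho => ?_⟩
  · exact (walkKernel_preimage_proj₂_ne_zero_iff x A hA).2 ⟨x, hx, rfl⟩
  · rw [walkKernel_preimage_proj₂_ne_zero_iff _ A hA, walkKernel_preimage_proj₂_ne_zero_iff _ A hA,
      show forget (proj₁ z) = forget (proj₂ z) from forget_eq_iff.2 ⟨z, rfl, rfl⟩]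
  · have := hinv (G.cls₂ o v)
    rw [proj₁_cls₂, proj₂_cls₂] at this
    exact this.1 ho

/-- Absolute continuity of the coupling lets it be disintegrated explicitly: its density with
respect to `μ₁.bind walkKernel`, multiplied by the weight of the kernel, is the root-change
function. -/
theorem ConditionF'.conditionR [IsProbabilityMeasure μ₁] [IsProbabilityMeasure μ₂]
    (h : ConditionF' μ₁ μ₂) : ConditionR μ₁ μ₂ := by
  obtain ⟨ρ, hac, h1, h2⟩ := h.exists_transport
  have : IsFiniteMeasure (μ₁.bind (walkKernel (Ξ := Ξ))) :=
    isFiniteMeasure_bind μ₁ measurable_walkKernel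
      (measure_univ_le_one_of_le_indicator walkKernel_preimage_proj₁_le)
  have : IsFiniteMeasure ρ := by
    refine ⟨?_⟩
    rw [← Set.preimage_univ (f := proj₁), ← Measure.map_apply measurable_proj₁ .univ, h1]
    exact measure_lt_top _ _
  set g := ρ.rnDeriv (μ₁.bind walkKernel) with hg
  have hgm : Measurable g := Measure.measurable_rnDeriv _ _
  -- Passing to finite values alters the density only on a null set, and the weight nowhere.
  set T : GStarStar Ξ → ℝ≥0 := fun z => (g z).toNNReal * (walkWeight z).toNNReal with hT
  have hTm : Measurable T := hgm.ennreal_toNNReal.mul measurable_walkWeight.ennreal_toNNReal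
  have hint (f : GStarStar Ξ → ℝ≥0∞) (hf : Measurable f) :
      ∫⁻ x, sumSecondRoot (fun z => (T z : ℝ≥0∞) * f z) x ∂μ₁ = ∫⁻ z, f z ∂ρ := by
    have hm : Measurable fun z => ((g z).toNNReal : ℝ≥0∞) * f z :=
      hgm.ennreal_toNNReal.coe_nnreal_ennreal.mul hf
    calc ∫⁻ x, sumSecondRoot (fun z => (T z : ℝ≥0∞) * f z) x ∂μ₁
        = ∫⁻ x, ∫⁻ z, ((g z).toNNReal : ℝ≥0∞) * f z ∂(walkKernel x) ∂μ₁ := by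
          refine lintegral_congr fun x => ?_
          rw [lintegral_walkKernel x hm]
          refine sumSecondRoot_ext fun z _ => ?_
          rw [hT]
          push_cast
          rw [ENNReal.coe_toNNReal (walkWeight_ne_top z)]
          ring
      _ = ∫⁻ z, ((g z).toNNReal : ℝ≥0∞) * f z ∂(μ₁.bind walkKernel) :=
          (Measure.lintegral_bind measurable_walkKernel.aemeasurable hm.aemeasurable).symm
      _ = ∫⁻ z, g z * f z ∂(μ₁.bind walkKernel) := by
          refine lintegral_congr_ae ?_
          filter_upwards [Measure.rnDeriv_ne_top ρ (μ₁.bind walkKernel)] with z hz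
          rw [ENNReal.coe_toNNReal hz]
      _ = ∫⁻ z, f z ∂ρ := lintegral_rnDeriv_mul hac hf.aemeasurable
  refine ⟨T, hTm, ?_, fun A hA => ?_⟩
  -- The total weight is identified as `1` by integrating it over arbitrary measurable sets, where
  -- it yields the first marginal of the coupling.
  · refine ae_eq_of_forall_setLIntegral_eq_of_sigmaFinite
      (measurable_sumSecondRoot hTm.coe_nnreal_ennreal) measurable_const fun A hA _ => ?_
    have hA' : MeasurableSet (proj₁ ⁻¹' A : Set (GStarStar Ξ)) := measurable_proj₁ hA
    rw [← lintegral_indicator hA, setLIntegral_one]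
    calc ∫⁻ x, A.indicator (sumSecondRoot fun z => (T z : ℝ≥0∞)) x ∂μ₁
        = ∫⁻ x, sumSecondRoot (fun z => (T z : ℝ≥0∞) * (proj₁ ⁻¹' A).indicator 1 z) x ∂μ₁ := by
          refine lintegral_congr fun x => ?_
          have h : (fun z : GStarStar Ξ => (T z : ℝ≥0∞) * (proj₁ ⁻¹' A).indicator 1 z) =
              fun z => A.indicator 1 (proj₁ z) * (T z : ℝ≥0∞) := funext fun z => mul_comm _ _
          rw [h, sumSecondRoot_proj₁_mul]
          by_cases hx : x ∈ A <;> simp [hx]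
      _ = μ₁ A := by
          rw [hint _ (measurable_one.indicator hA'), lintegral_indicator_one hA',
            ← Measure.map_apply measurable_proj₁ hA, h1]
  · have hA' : MeasurableSet (proj₂ ⁻¹' A : Set (GStarStar Ξ)) := measurable_proj₂ hA
    calc μ₂ A = ∫⁻ z, (proj₂ ⁻¹' A).indicator 1 z ∂ρ := by
          rw [lintegral_indicator_one hA', ← Measure.map_apply measurable_proj₂ hA, h2]
      _ = _ := (hint _ (measurable_one.indicator hA')).symm

theorem isBiasing_self (μ : Measure (GStar Ξ)) [IsProbabilityMeasure μ] : IsBiasing μ μ :=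
  ⟨1, measurable_one, by simp, by simp, fun A hA => by simp⟩

/-- The biasing can be trivial in both directions, since agreement on invariant sets is symmetric
and already gives both root-changes. -/
theorem ConditionF'.conditionB [IsProbabilityMeasure μ₁] [IsProbabilityMeasure μ₂]
    (h : ConditionF' μ₁ μ₂) : ConditionB μ₁ μ₂ :=
  ⟨⟨μ₁, isBiasing_self μ₁, h.conditionR⟩, μ₂, isBiasing_self μ₂,
    ConditionF'.conditionR fun A hA => (h A hA).symm⟩

end Equivalence

end UnrootedEquivalence

end

theorem mainTheorem2 {Ξ : Type u} [MetricSpace Ξ] [CompleteSpace Ξ]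
    [TopologicalSpace.SeparableSpace Ξ] (μ₁ μ₂ : Measure (GStar Ξ))
    [IsProbabilityMeasure μ₁] [IsProbabilityMeasure μ₂] :
    List.TFAE [ConditionR μ₁ μ₂, ConditionC μ₁ μ₂, ConditionD μ₁ μ₂, ConditionF μ₁ μ₂,
      ConditionF' μ₁ μ₂] ∧
    (ConditionR μ₁ μ₂ → ConditionB μ₁ μ₂) ∧ (ConditionC μ₁ μ₂ → ConditionB μ₁ μ₂) ∧
    (ConditionD μ₁ μ₂ → ConditionB μ₁ μ₂) ∧ (ConditionF μ₁ μ₂ → ConditionB μ₁ μ₂) ∧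
    (ConditionF' μ₁ μ₂ → ConditionB μ₁ μ₂) := by
  have hDC : ConditionD μ₁ μ₂ → ConditionC μ₁ μ₂ := fun h => h.conditionC
  have hCF' : ConditionC μ₁ μ₂ → ConditionF' μ₁ μ₂ := fun h => h.conditionF.conditionF'
  have hRD : ConditionR μ₁ μ₂ → ConditionD μ₁ μ₂ := fun h => h.conditionD
  refine ⟨?_, fun h => (hCF' (hDC (hRD h))).conditionB, fun h => (hCF' h).conditionB,
    fun h => (hCF' (hDC h)).conditionB, fun h => h.conditionF'.conditionB, fun h => h.conditionB⟩
  tfae_have 1 → 3 := hRD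
  tfae_have 3 → 2 := hDC
  tfae_have 2 → 4 := fun h => h.conditionF
  tfae_have 4 → 5 := fun h => h.conditionF'
  tfae_have 5 → 1 := fun h => h.conditionR
  tfae_finish
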